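/- Let $\iota_1:\Sigma\to\Gamma_1$ and $\iota_2:\Sigma\to\Gamma_2$ be injective morphisms of countable groups, with images $\Sigma_1,\Sigma_2$, and let $\Gamma=\Gamma_1*_\Sigma\Gamma_2$ be the associated amalgamated free product. Assume that it is non-degenerate: $\Sigma_1\neq\Gamma_1$, $\Sigma_2\neq\Gamma_2$, and $[\Gamma_1:\Sigma_1]\ge 3$ or $[\Gamma_2:\Sigma_2]\ge 3$ (the index may be infinite). Let $\mathcal T$ be its Bass–Serre tree, with vertex set $\Gamma/\Gamma_1\sqcup\Gamma/\Gamma_2$ and with an edge from $\gamma\Gamma_1$ to $\gamma\Gamma_2$ for each coset $\gamma\Sigma\in\Gamma/\Sigma$. Let $\partial\mathcal T$ be the space of its ends (classes of geodesic rays, where two rays are equivalent if their ranges differ by a finite set), with the topology whose basic open sets are the sets of ends of half-trees. Assume that the action of $\Gamma$ on $\partial\mathcal T$ is topologically free, i.e. that the trivial element is the only element of $\Gamma$ that fixes a non-empty open subset of $\partial\mathcal T$ pointwise. An action of a group on an infinite countable set $X$ is highly transitive if for every $k\ge 1$ any $k$-tuple of pairwise distinct points of $X$ can be sent to any other such $k$-tuple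 by an element of the group. It is highly faithful if for every finite set $F$ of non-trivial elements of the group there are infinitely many points of $X$ that are moved by every element of $F$. A group is highly transitive if it has a faithful and highly transitive action on an infinite countable set. Then: (1) $\Gamma$ admits an action on an infinite countable set which is both highly transitive and highly faithful; in particular, $\Gamma$ is a highly transitive group. (2) Fix free actions of $\Gamma_1$ and $\Gamma_2$ on countable sets $X_1$ and $X_2$ respectively, each with infinitely many orbits. Let $\mathbf{PA}$ be the set of bijections $\tau:X_1\to X_2$ such that $\tau(\iota_1(\sigma)x)=\iota_2(\sigma)\tau(x)$ for all $\sigma\in\Sigma$ and $x\in X_1$, with the topology of pointwise convergence ($X_2$ being discrete). For $\tau\in\mathbf{PA}$ let $\pi_\tau$ be the action of $\Gamma$ on $X_1$ in which $\Gamma_1$ acts as given and $h\in\Gamma_2$ acts by $x\mapsto\tau^{-1}(h\,\tau(x))$. Let $\mathbf{TA}$, $\mathbf{HTA}$, $\mathbf{HFA}$ be the sets of those $\tau\in\mathbf{PA}$ for which $\pi_\tau$ is transitive, highly transitive, highly faithful, respectively. Then $\mathbf{HTA}\cap\mathbf{HFA}$ is a non-empty subset of $\mathbf{TA}$, and it is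 a dense $G_\delta$ subset of the space $\mathbf{TA}$. -/

import Mathlib

namespace AmalgamHT

/-! ### Graphs, geodesic rays, half-trees and the boundary of a tree -/

/-- A graph in the sense of Serre, with vertex set `V` and edge set `E`: a source map and a
fixed-point-free involution (the antipode map) on the edges. The range of an edge is the source of
its antipode, see `SerreGraph.rng`. -/
structure SerreGraph (V E : Type*) where
  src : E → V
  bar : E → E
  bar_bar : ∀ e, bar (bar e) = e
  bar_ne : ∀ e, bar e ≠ e

namespace SerreGraph

variable {V E : Type*} (T : SerreGraph V E)

/-- The range of an edge. -/
def rng (e : E) : V := T.src (T.bar e)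

/-- `T.IsPath u l v`: the list of edges `l` is a path from the vertex `u` to the vertex `v`
(the empty list is the path of length `0` at a vertex). -/
def IsPath : V → List E → V → Prop
  | u, [], v => u = v
  | u, e :: l, v => T.src e = u ∧ IsPath (T.rng e) l v

/-- A list of consecutive edges without backtracking. -/
def IsReducedPath (l : List E) : Prop :=
  l.IsChain (fun e f => T.rng e = T.src f ∧ f ≠ T.bar e)

/-- The edge set of the half-graph of an edge `e` (its half-tree, when the ambient graph is a
tree): the smallest set of edges, closed under the antipode map, that contains the last edge of
every reduced path that starts by `e` and does not use the antipode of `e`. -/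
def halfGraph (e : E) : Set E :=
  {f | ∃ l : List E, T.IsReducedPath (e :: l) ∧ T.bar e ∉ e :: l ∧
    ((e :: l).getLast (List.cons_ne_nil e l) = f ∨
      (e :: l).getLast (List.cons_ne_nil e l) = T.bar f)}

/-- A geodesic ray: an infinite path `(e_n)` such that, for `i ≤ j`, every path from its `i`-th
vertex to its `j`-th vertex has length at least `j - i` (so that the distance between these two
vertices is exactly `j - i`). The `n`-th vertex is the source of the edge `e_n`. -/
structure Ray where
  edge : ℕ → E
  rng_edge : ∀ n, T.rng (edge n) = T.src (edge (n + 1))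
  geodesic : ∀ i j, i ≤ j → ∀ l : List E,
    T.IsPath (T.src (edge i)) l (T.src (edge j)) → j - i ≤ l.length

namespace Ray

variable {T}

@[ext]
theorem ext {ω ω' : T.Ray} (h : ∀ n, ω.edge n = ω'.edge n) : ω = ω' := by
  cases ω; cases ω'; congr; exact funext h

/-- The range of a ray: the set of its vertices. -/
def verts (ω : T.Ray) : Set V := Set.range fun n => T.src (ω.edge n)

end Ray

/-- Two geodesic rays are equivalent if their ranges differ by a finite set. -/
instance raySetoid : Setoid T.Ray where
  r ω ω' := (symmDiff ω.verts ω'.verts).Finite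
  iseqv :=
    { refl := fun ω => by simp
      symm := fun {ω ω'} h => by rwa [symmDiff_comm]
      trans := fun {a b c} h h' => (h.union h').subset (symmDiff_triangle _ _ _) }

/-- The boundary (set of ends). -/
def Boundary : Type _ := Quotient T.raySetoid

/-- The class of a geodesic ray in the boundary. -/
def Ray.toBoundary {T : SerreGraph V E} (ω : T.Ray) : T.Boundary := Quotient.mk T.raySetoid ω

/-- The set of classes of the geodesic rays that are contained in the half-graph of `e`. -/
def boundaryOf (e : E) : Set T.Boundary :=
  {ξ | ∃ ω : T.Ray, (∀ n, ω.edge n ∈ T.halfGraph e) ∧ ω.toBoundary = ξ}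

/-- The topology of the boundary, generated by the sets of ends of half-trees. -/
instance : TopologicalSpace T.Boundary :=
  TopologicalSpace.generateFrom (Set.range T.boundaryOf)

/-- The group `Γ`, which acts on the vertices and on the edges, acts by graph automorphisms. -/
class IsGraphAction (Γ : Type*) [Group Γ] [MulAction Γ V] [MulAction Γ E] : Prop where
  src_smul : ∀ (γ : Γ) (e : E), T.src (γ • e) = γ • T.src e
  bar_smul : ∀ (γ : Γ) (e : E), T.bar (γ • e) = γ • T.bar e

section Action

variable {T} {Γ : Type*} [Group Γ] [MulAction Γ V] [MulAction Γ E] [T.IsGraphAction Γ]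

theorem rng_smul (γ : Γ) (e : E) : T.rng (γ • e) = γ • T.rng e := by
  simp only [rng, IsGraphAction.bar_smul, IsGraphAction.src_smul]

theorem IsPath.smul (γ : Γ) : ∀ {u v : V} {l : List E}, T.IsPath u l v →
    T.IsPath (γ • u) (l.map (γ • ·)) (γ • v)
  | u, v, [], h => congrArg (γ • ·) h
  | u, v, e :: l, h => by
    refine ⟨?_, ?_⟩
    · rw [IsGraphAction.src_smul, h.1]
    · have := IsPath.smul γ h.2
      rwa [← rng_smul] at this

/-- The action on the geodesic rays. -/
instance : MulAction Γ T.Ray where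
  smul γ ω :=
    { edge := fun n => γ • ω.edge n
      rng_edge := fun n => by rw [rng_smul, ω.rng_edge, IsGraphAction.src_smul]
      geodesic := fun i j hij l hl => by
        rw [IsGraphAction.src_smul, IsGraphAction.src_smul] at hl
        have := hl.smul γ⁻¹
        rw [inv_smul_smul, inv_smul_smul] at this
        simpa using ω.geodesic i j hij _ this }
  one_smul ω := Ray.ext fun n => one_smul Γ (ω.edge n)
  mul_smul γ δ ω := Ray.ext fun n => mul_smul γ δ (ω.edge n)

theorem Ray.smul_edge (γ : Γ) (ω : T.Ray) (n : ℕ) : (γ • ω).edge n = γ • ω.edge n := rfl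

theorem Ray.verts_smul (γ : Γ) (ω : T.Ray) : (γ • ω).verts = (γ • ·) '' ω.verts := by
  ext v
  simp only [Ray.verts, Set.mem_range, Set.mem_image, exists_exists_eq_and, Ray.smul_edge,
    IsGraphAction.src_smul]

/-- The induced action on the boundary. -/
instance : MulAction Γ T.Boundary where
  smul γ := Quotient.map (γ • ·) fun ω ω' (h : (symmDiff ω.verts ω'.verts).Finite) => by
    change (symmDiff (γ • ω).verts (γ • ω').verts).Finite
    rw [Ray.verts_smul, Ray.verts_smul, ← Set.image_symmDiff (MulAction.injective γ)]
    exact h.image _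
  one_smul ξ := by
    induction ξ using Quotient.inductionOn with
    | h ω => exact congrArg Ray.toBoundary (one_smul Γ ω)
  mul_smul γ δ ξ := by
    induction ξ using Quotient.inductionOn with
    | h ω => exact congrArg Ray.toBoundary (mul_smul γ δ ω)

theorem smul_toBoundary (γ : Γ) (ω : T.Ray) : γ • ω.toBoundary = (γ • ω).toBoundary := rfl

end Action

end SerreGraph

/-- An action on a topological space is topologically free if the trivial element is the only one
that fixes a non-empty open subset pointwise. -/
def TopologicallyFree (Γ Y : Type*) [Group Γ] [MulAction Γ Y] [TopologicalSpace Y] : Prop :=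
  ∀ γ : Γ, (∃ U : Set Y, IsOpen U ∧ U.Nonempty ∧ ∀ y ∈ U, γ • y = y) → γ = 1

/-! ### Amalgams and their Bass–Serre trees -/

section Amalgam

variable {G : Fin 2 → Type*} {S : Type*} [∀ j, Group (G j)] [Group S] (φ : ∀ j, S →* G j)

/-- The amalgam of `Γ₁ = G 0` and `Γ₂ = G 1` over `Σ = S`, with respect to the (injective)
morphisms `φ 0 : Σ → Γ₁` and `φ 1 : Σ → Γ₂`. -/
abbrev Amalgam : Type _ := Monoid.PushoutI φ

/-- The copy of `Γ_j` in the amalgam. -/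
def factor (j : Fin 2) : Subgroup (Amalgam φ) := (Monoid.PushoutI.of (φ := φ) j).range

/-- The copy of `Σ` in the amalgam. -/
def edgeGroup : Subgroup (Amalgam φ) := (Monoid.PushoutI.base φ).range

theorem edgeGroup_le_factor (j : Fin 2) : edgeGroup φ ≤ factor φ j := by
  rintro _ ⟨s, rfl⟩
  exact ⟨φ j s, Monoid.PushoutI.of_apply_eq_base φ j s⟩

/-- Non-degenerate amalgams: `Σ` is a proper subgroup of `Γ₁` and of `Γ₂`, of index at least `3`
(possibly infinite) in one of them. -/
def NonDegenerate : Prop :=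
  (∀ j, (φ j).range ≠ ⊤) ∧ ∃ j, (3 : ℕ∞) ≤ ENat.card (G j ⧸ (φ j).range)

/-- The vertices of the Bass–Serre tree: the disjoint union of `Γ / Γ₁` and `Γ / Γ₂`. -/
abbrev BSVertex : Type _ := Σ j : Fin 2, Amalgam φ ⧸ factor φ j

/-- The edges of the Bass–Serre tree: two copies of `Γ / Σ`; the positive edges are those with
first component `0`, and the negative ones those with first component `1`. -/
abbrev BSEdge : Type _ := Σ _ : Fin 2, Amalgam φ ⧸ edgeGroup φ

/-- The Bass–Serre tree. The positive edge `γ Σ` goes from `γ Γ₁` to `γ Γ₂`, and its antipode, the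
negative edge `γ Σ`, goes from `γ Γ₂` to `γ Γ₁`. -/
def bassSerreTree : SerreGraph (BSVertex φ) (BSEdge φ) where
  src e := ⟨e.1, Subgroup.quotientMapOfLE (edgeGroup_le_factor φ e.1) e.2⟩
  bar e := ⟨e.1.rev, e.2⟩
  bar_bar e := by simp
  bar_ne e h := by
    obtain ⟨j, q⟩ := e
    have h' : j.rev = j := congrArg Sigma.fst h
    revert h'
    fin_cases j <;> decide

/-- The amalgam acts by left translations on its Bass–Serre tree. -/
instance : (bassSerreTree φ).IsGraphAction (Amalgam φ) where
  src_smul γ e := by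
    obtain ⟨j, q⟩ := e
    induction q using QuotientGroup.induction_on with
    | H δ => rfl
  bar_smul γ e := rfl

end Amalgam

/-! ### Transitivity and faithfulness of actions, given as morphisms to permutation groups -/

section Actions

variable {Γ X : Type*} [Group Γ]

/-- Transitive actions. -/
def IsTransitive (α : Γ →* Equiv.Perm X) : Prop := ∀ x y : X, ∃ γ : Γ, α γ x = y

/-- Highly transitive actions: for all `k`, any `k`-tuple of pairwise distinct points can be sent
to any other such `k`-tuple. -/
def IsHighlyTransitive (α : Γ →* Equiv.Perm X) : Prop :=
  ∀ (k : ℕ) (x y : Fin k → X), Function.Injective x → Function.Injective y →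
    ∃ γ : Γ, ∀ i, α γ (x i) = y i

/-- Highly faithful actions: for every finite set `F` of non-trivial elements, the intersection of
the supports of the elements of `F` is infinite. -/
def IsHighlyFaithful (α : Γ →* Equiv.Perm X) : Prop :=
  ∀ F : Finset Γ, 1 ∉ F → {x : X | ∀ γ ∈ F, α γ x ≠ x}.Infinite

variable (Γ) in
/-- Highly transitive groups: those that admit a faithful and highly transitive action on an
infinite countable set. -/
def IsHighlyTransitiveGroup : Prop :=
  ∃ (X : Type) (α : Γ →* Equiv.Perm X), Countable X ∧ Infinite X ∧
    Function.Injective α ∧ IsHighlyTransitive α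

end Actions

/-! ### The space of global pre-actions -/

section PreActions

variable {G : Fin 2 → Type*} {S : Type*} [∀ j, Group (G j)] [Group S] (φ : ∀ j, S →* G j)
variable (X : Fin 2 → Type*) [∀ j, MulAction (G j) (X j)]

/-- The space `PA` of the bijections from `X₁ = X 0` onto `X₂ = X 1` that intertwine the two
actions of `Σ`. -/
def PA : Type _ := {τ : X 0 ≃ X 1 // ∀ (s : S) (x : X 0), τ (φ 0 s • x) = φ 1 s • τ x}

/-- The topology of pointwise convergence, `X₂` being discrete. -/
instance : TopologicalSpace (PA φ X) :=
  TopologicalSpace.induced (fun τ (x : X 0) => τ.1 x)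
    (@Pi.topologicalSpace (X 0) (fun _ => X 1) fun _ => ⊥)

variable {φ X}

/-- The action of `Γ_j` on `X₁` that is given by `τ`: the given one for `j = 0`, and the conjugate
by `τ` of the given action on `X₂` for `j = 1`. -/
def PA.factorHom (τ : PA φ X) : ∀ j : Fin 2, G j →* Equiv.Perm (X 0)
  | 0 => MulAction.toPermHom (G 0) (X 0)
  | 1 => (τ.1.symm.permCongrHom.toMonoidHom).comp (MulAction.toPermHom (G 1) (X 1))

theorem PA.factorHom_zero_apply (τ : PA φ X) (g : G 0) (x : X 0) :
    τ.factorHom 0 g x = g • x := rfl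

theorem PA.factorHom_one_apply (τ : PA φ X) (h : G 1) (x : X 0) :
    τ.factorHom 1 h x = τ.1.symm (h • τ.1 x) := rfl

/-- The action `π_τ` of the amalgam on `X₁`: the only one such that `Γ₁` acts as given and
`h` in `Γ₂` acts by `x ↦ τ⁻¹ (h • τ x)`. -/
def PA.action (τ : PA φ X) : Amalgam φ →* Equiv.Perm (X 0) :=
  Monoid.PushoutI.lift τ.factorHom ((τ.factorHom 0).comp (φ 0)) fun j => by
    fin_cases j
    · rfl
    · ext s x
      change τ.1.symm (φ 1 s • τ.1 x) = φ 0 s • x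
      rw [← τ.2, Equiv.symm_apply_apply]

variable (φ X)

/-- The `τ` in `PA` such that `π_τ` is transitive. -/
def TA : Set (PA φ X) := {τ | IsTransitive τ.action}

/-- The `τ` in `PA` such that `π_τ` is highly transitive. -/
def HTA : Set (PA φ X) := {τ | IsHighlyTransitive τ.action}

/-- The `τ` in `PA` such that `π_τ` is highly faithful. -/
def HFA : Set (PA φ X) := {τ | IsHighlyFaithful τ.action}

end PreActions

end AmalgamHT

/-! The proof is a Baire category argument, run on finite approximations of `τ`. Picture the orbits
of Γ₁ and Γ₂ as the vertices of a graph and the Σ-classes matched by `τ` as its edges; a point of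
`Pt X` then stands for a directed edge that leaves its orbit. A `State` is a finite part of such a
graph in which every component keeps an unmatched class. Finite parts of a transitive `τ` have this
property (`exists_state_of_mem_TA`): a saturated component would be Γ-invariant, although it meets
finitely many orbits only. Conversely, `exists_generic` extends any state to a `τ` that meets
countably many dense requirements. Each requirement is open, which gives the Gδ part, and two
densities remain.

High faithfulness (`exists_forces_moved`): start in a fresh orbit and attach a further fresh orbit
whenever the action is still undefined. No loop is ever closed, so the points reached carry
consistent labels in Γ; a non-trivial γ sends the point labelled 1 to a point labelled γ, which is
another one.

High transitivity (`exists_forces_tuple`): an auxiliary tuple reduces the problem to disjoint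
tuples. Once a single γ has moved all the points concerned to unmatched points in distinct Σ-classes
(`exists_displacement`), each source is joined to its target through a fresh orbit
(`State.exists_connect`); index at least 3 leaves a class of that orbit unmatched. The displacement
frees the points one at a time. Points already freed keep walking into fresh orbits. A captive point
can walk out without backtracking (`State.exists_succ_notMem_dom`): a set of matched directed edges
that is closed under successors is, by counting, closed under reversal as well, hence a union of
saturated components. If the captive emerges in the Σ-class of a freed point, the two differ by some
s ≠ 1 in Σ, and a common walk that conjugates s out of Σ (`Sep`) separates them.

Topological freeness is what provides `Sep` (`TopologicallyFree.sep`): an s that no walk conjugates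
out of Σ fixes all the edges of a half-tree, hence all its ends. These form a non-empty open set,
because the half-tree contains an alternating ray, geodesic by the normal form theorem. -/

namespace AmalgamHT

/-! ### Points, Σ-classes and orbits. -/

section Points

variable {G : Fin 2 → Type*} {S : Type*} [∀ j, Group (G j)] [Group S] (φ : ∀ j, S →* G j)
variable (X : Fin 2 → Type*) [∀ j, MulAction (G j) (X j)]

/-- The disjoint union of the two spaces. -/
abbrev Pt (X : Fin 2 → Type*) : Type _ := Σ j, X j

/-- Standing hypotheses: both actions are free with infinitely many orbits, and the common
subgroup is proper in both factors. -/
structure FreePair : Prop where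
  inj : ∀ j, Function.Injective (φ j)
  free : ∀ (j : Fin 2) (g : G j) (x : X j), g • x = x → g = 1
  orbits : ∀ j, Infinite (MulAction.orbitRel.Quotient (G j) (X j))
  proper : ∀ j, ∃ g : G j, g ∉ (φ j).range

/-- The image of `φ j` has index at least `3`, in the form in which it is used. -/
def Wide (j : Fin 2) : Prop :=
  ∀ h : G j, ∃ g : G j, g ∉ (φ j).range ∧ g * h⁻¹ ∉ (φ j).range

variable {X}

/-- The action of the common subgroup on the disjoint union. -/
def tw (s : S) (a : Pt X) : Pt X := ⟨a.1, φ a.1 s • a.2⟩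

theorem tw_mk (s : S) (j : Fin 2) (x : X j) : tw φ s ⟨j, x⟩ = ⟨j, φ j s • x⟩ := rfl

theorem tw_tw (s t : S) (a : Pt X) : tw φ s (tw φ t a) = tw φ (s * t) a :=
  Sigma.ext rfl (by simp [tw, mul_smul])

theorem tw_one (a : Pt X) : tw φ 1 a = a := by
  simp [tw]

theorem tw_inv_tw (s : S) (a : Pt X) : tw φ s⁻¹ (tw φ s a) = a := by
  rw [tw_tw, inv_mul_cancel, tw_one]

theorem tw_tw_inv (s : S) (a : Pt X) : tw φ s (tw φ s⁻¹ a) = a := by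
  rw [tw_tw, mul_inv_cancel, tw_one]

theorem exists_tw_symm {a b : Pt X} (h : ∃ s, a = tw φ s b) : ∃ s, b = tw φ s a := by
  obtain ⟨s, rfl⟩ := h
  exact ⟨s⁻¹, (tw_inv_tw φ s b).symm⟩

theorem exists_tw_trans {a b c : Pt X} (h : ∃ s, a = tw φ s b) (h' : ∃ s, b = tw φ s c) :
    ∃ s, a = tw φ s c := by
  obtain ⟨s, rfl⟩ := h
  obtain ⟨t, rfl⟩ := h'
  exact ⟨s * t, tw_tw φ s t c⟩

variable {φ} in
theorem FreePair.tw_inj (H : FreePair φ X) {s t : S} {a : Pt X} (h : tw φ s a = tw φ t a) :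
    s = t := by
  obtain ⟨j, x⟩ := a
  simp only [tw_mk, Sigma.mk.injEq, heq_eq_eq, true_and] at h
  have : (φ j t)⁻¹ * φ j s = 1 := H.free j _ x (by rw [mul_smul, h, inv_smul_smul])
  exact H.inj j (inv_mul_eq_one.1 this).symm

variable {φ} in
theorem FreePair.smul_inj (H : FreePair φ X) {j : Fin 2} {g h : G j} {x : X j}
    (e : g • x = h • x) : g = h := by
  have : h⁻¹ * g = 1 := H.free j _ x (by rw [mul_smul, e, inv_smul_smul])
  exact (inv_mul_eq_one.1 this).symm

/-- Two points are in the same orbit of one of the two factors. -/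
inductive SameOrb : Pt X → Pt X → Prop
  | mk (j : Fin 2) (g : G j) (x : X j) : SameOrb (Sigma.mk j x) ⟨j, g • x⟩

theorem SameOrb.refl (a : Pt X) : SameOrb (G := G) a a := by
  obtain ⟨j, x⟩ := a
  simpa using SameOrb.mk j (1 : G j) x

theorem SameOrb.symm {a b : Pt X} (h : SameOrb (G := G) a b) : SameOrb (G := G) b a := by
  obtain ⟨j, g, x⟩ := h
  simpa using SameOrb.mk j g⁻¹ (g • x)

theorem SameOrb.trans {a b c : Pt X} (h : SameOrb (G := G) a b) (h' : SameOrb (G := G) b c) :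
    SameOrb (G := G) a c := by
  obtain ⟨j, g, x⟩ := h
  cases h' with
  | mk _ g' _ => simpa [mul_smul] using SameOrb.mk j (g' * g) x

theorem SameOrb.tw (s : S) (a : Pt X) : SameOrb (G := G) a (tw φ s a) :=
  SameOrb.mk a.1 (φ a.1 s) a.2

theorem SameOrb.fst {a b : Pt X} (h : SameOrb (G := G) a b) : a.1 = b.1 := by
  cases h; rfl

theorem sameOrb_mk_iff {j : Fin 2} {x y : X j} :
    SameOrb (G := G) (⟨j, x⟩ : Pt X) ⟨j, y⟩ ↔ ∃ g : G j, y = g • x := by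
  constructor
  · intro h
    cases h with
    | mk => exact ⟨_, rfl⟩
  · rintro ⟨g, rfl⟩
    exact SameOrb.mk j g x

variable {φ} in
theorem FreePair.smul_ne_tw (H : FreePair φ X) {j : Fin 2} {g : G j} (hg : g ∉ (φ j).range)
    (v : X j) (s : S) : (⟨j, g • v⟩ : Pt X) ≠ tw φ s ⟨j, v⟩ := by
  intro h
  simp only [tw_mk, Sigma.mk.injEq, heq_eq_eq, true_and] at h
  exact hg ⟨s, (H.smul_inj h).symm⟩

variable {φ} in
theorem FreePair.exists_notMem_orbits (H : FreePair φ X) (i : Fin 2) {A : Set (Pt X)}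
    (hA : A.Finite) : ∃ v : X i, ∀ y ∈ A, ¬ SameOrb (G := G) y ⟨i, v⟩ := by
  have := H.orbits i
  have hfin : ((fun x : X i => (Quotient.mk _ x : MulAction.orbitRel.Quotient (G i) (X i))) ''
      (Sigma.mk i ⁻¹' A)).Finite := (hA.preimage sigma_mk_injective.injOn).image _
  obtain ⟨q, hq⟩ := hfin.exists_notMem
  obtain ⟨v, rfl⟩ := Quotient.exists_rep q
  refine ⟨v, ?_⟩
  rintro ⟨j, y⟩ hy ho
  obtain rfl : j = i := ho.fst
  obtain ⟨g, rfl⟩ := sameOrb_mk_iff.1 ho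
  refine hq ⟨y, hy, Quotient.sound (MulAction.orbitRel_apply.2 ⟨g⁻¹, ?_⟩)⟩
  simp

/-- Points that are linked by a finite sequence of moves along `r` and inside of orbits. -/
def Conn (r : Pt X → Pt X → Prop) : Pt X → Pt X → Prop :=
  Relation.ReflTransGen fun a b => r a b ∨ SameOrb (G := G) a b

theorem Conn.mono {r r' : Pt X → Pt X → Prop} (h : ∀ a b, r a b → r' a b) {a b : Pt X}
    (hc : Conn (G := G) r a b) : Conn (G := G) r' a b :=
  Relation.ReflTransGen.mono (fun a b => Or.imp (h a b) id) _ _ hc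

theorem Conn.orb {r : Pt X → Pt X → Prop} {a b c : Pt X}
    (hc : Conn (G := G) r a b) (h : SameOrb (G := G) b c) : Conn (G := G) r a c :=
  Relation.ReflTransGen.tail hc (Or.inr h)

theorem Conn.rel {r : Pt X → Pt X → Prop} {a b c : Pt X}
    (hc : Conn (G := G) r a b) (h : r b c) : Conn (G := G) r a c :=
  Relation.ReflTransGen.tail hc (Or.inl h)

theorem Conn.refl {r : Pt X → Pt X → Prop} (a : Pt X) : Conn (G := G) r a a :=
  Relation.ReflTransGen.refl

/-! ### Finite equivariant matchings and their extension by fresh orbits. -/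

variable (X) in
/-- A partial equivariant matching between the two spaces, with finitely many classes, in whose
graph every component has a missing edge. -/
structure State where
  rel : Pt X → Pt X → Prop
  symm : ∀ {a b}, rel a b → rel b a
  uniq : ∀ {a b c}, rel a b → rel a c → b = c
  fiber : ∀ {a b}, rel a b → a.1 ≠ b.1
  twist : ∀ {a b} (s : S), rel a b → rel (tw φ s a) (tw φ s b)
  fin : ∃ D : Set (Pt X), D.Finite ∧ ∀ a b, rel a b → ∃ s, ∃ d ∈ D, a = tw φ s d
  exit : ∀ a, ∃ e, (∀ b, ¬ rel e b) ∧ Conn (G := G) rel a e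

namespace State

variable {φ}

instance : Preorder (State φ X) where
  le p q := ∀ a b, p.rel a b → q.rel a b
  le_refl _ _ _ h := h
  le_trans _ _ _ h h' a b k := h' a b (h a b k)

/-- The points at which the matching is defined. -/
def dom (p : State φ X) : Set (Pt X) := {a | ∃ b, p.rel a b}

theorem dom_mono {p q : State φ X} (h : p ≤ q) : p.dom ⊆ q.dom :=
  fun a ⟨b, hb⟩ => ⟨b, h a b hb⟩

theorem tw_mem_dom {p : State φ X} {a : Pt X} (s : S) (h : a ∈ p.dom) :
    tw φ s a ∈ p.dom :=
  let ⟨_, hb⟩ := h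
  ⟨_, p.twist s hb⟩

theorem tw_mem_dom_iff {p : State φ X} {a : Pt X} (s : S) :
    tw φ s a ∈ p.dom ↔ a ∈ p.dom :=
  ⟨fun h => by simpa only [tw_inv_tw] using tw_mem_dom s⁻¹ h, tw_mem_dom s⟩

theorem right_mem_dom {p : State φ X} {a b : Pt X} (h : p.rel a b) : b ∈ p.dom :=
  ⟨a, p.symm h⟩

theorem exists_rel {p : State φ X} {i j : Fin 2} (hij : i ≠ j) {x : X j}
    (h : (⟨j, x⟩ : Pt X) ∈ p.dom) : ∃ v : X i, p.rel ⟨j, x⟩ ⟨i, v⟩ := by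
  obtain ⟨⟨i', v⟩, hv⟩ := h
  have h1 : j ≠ i' := p.fiber hv
  obtain rfl : i' = i := by omega
  exact ⟨v, hv⟩

/-- An orbit that does not meet the domain of a state. -/
def Fresh (p : State φ X) (v : Pt X) : Prop := ∀ y ∈ p.dom, ¬ SameOrb (G := G) y v

/-- A state meets finitely many orbits, since its domain is covered by finitely many Σ-classes;
there are infinitely many orbits of each factor. -/
theorem exists_fresh (H : FreePair φ X) (p : State φ X) (i : Fin 2) {A : Set (Pt X)}
    (hA : A.Finite) : ∃ v : X i, p.Fresh ⟨i, v⟩ ∧ ∀ y ∈ A, ¬ SameOrb (G := G) y ⟨i, v⟩ := by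
  obtain ⟨D, hD, hp⟩ := p.fin
  obtain ⟨v, hv⟩ := H.exists_notMem_orbits i (hD.union hA)
  refine ⟨v, ?_, fun y hy => hv y (Or.inr hy)⟩
  rintro y ⟨b, hb⟩ ho
  obtain ⟨s, d, hd, rfl⟩ := hp y b hb
  exact hv d (Or.inl hd) ((SameOrb.tw φ s d).trans ho)

/-- The relation of a state with one more class of edges. -/
def edgeRel (p : State φ X) (a b c d : Pt X) : Prop :=
  p.rel c d ∨ ∃ s, (c = tw φ s a ∧ d = tw φ s b) ∨
    (c = tw φ s b ∧ d = tw φ s a)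

/-- Adds a class of edges to a state. -/
def addEdge (H : FreePair φ X) (p : State φ X) (a b : Pt X) (ha : a ∉ p.dom) (hb : b ∉ p.dom)
    (hab : a.1 ≠ b.1) (hexit : ∀ c, ∃ e, (∀ d, ¬ p.edgeRel a b e d) ∧
      Conn (G := G) (p.edgeRel a b) c e) : State φ X where
  rel := p.edgeRel a b
  symm := by
    rintro c d (h | ⟨s, h | h⟩)
    · exact Or.inl (p.symm h)
    · exact Or.inr ⟨s, Or.inr h.symm⟩
    · exact Or.inr ⟨s, Or.inl h.symm⟩
  uniq := by
    have hfib : ∀ s t, tw φ s a ≠ tw φ t b := fun s t h => by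
      have h' := congrArg Sigma.fst h
      exact hab h'
    rintro c d d' (h | ⟨s, ⟨rfl, rfl⟩ | ⟨rfl, rfl⟩⟩) (h' | ⟨t, ⟨h1, rfl⟩ | ⟨h1, rfl⟩⟩)
    -- Two old edges agree, an old and a new one have disjoint sources as `a` and `b` are out of the
    -- domain, and for two new ones freeness makes the translating element of Σ unique.
    · exact p.uniq h h'
    · exact absurd ⟨d, h1 ▸ h⟩ ((tw_mem_dom_iff t).not.2 ha)
    · exact absurd ⟨d, h1 ▸ h⟩ ((tw_mem_dom_iff t).not.2 hb)
    · exact absurd ⟨_, h'⟩ ((tw_mem_dom_iff s).not.2 ha)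
    · rw [H.tw_inj h1]
    · exact absurd h1 (hfib _ _)
    · exact absurd ⟨_, h'⟩ ((tw_mem_dom_iff s).not.2 hb)
    · exact absurd h1.symm (hfib _ _)
    · rw [H.tw_inj h1]
  fiber := by
    rintro c d (h | ⟨s, ⟨rfl, rfl⟩ | ⟨rfl, rfl⟩⟩)
    · exact p.fiber h
    · exact hab
    · exact hab.symm
  twist := by
    rintro c d t (h | ⟨s, ⟨rfl, rfl⟩ | ⟨rfl, rfl⟩⟩)
    · exact Or.inl (p.twist t h)
    · exact Or.inr ⟨t * s, Or.inl ⟨tw_tw φ _ _ _, tw_tw φ _ _ _⟩⟩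
    · exact Or.inr ⟨t * s, Or.inr ⟨tw_tw φ _ _ _, tw_tw φ _ _ _⟩⟩
  fin := by
    obtain ⟨D, hD, h⟩ := p.fin
    refine ⟨insert a (insert b D), (hD.insert b).insert a, ?_⟩
    rintro c d (h' | ⟨s, ⟨rfl, rfl⟩ | ⟨rfl, rfl⟩⟩)
    · obtain ⟨s, d, hd, e⟩ := h _ _ h'
      exact ⟨s, d, by simp [hd], e⟩
    · exact ⟨s, a, by simp, rfl⟩
    · exact ⟨s, b, by simp, rfl⟩
  exit := hexit

theorem edgeRel_dom {p : State φ X} {a b c d : Pt X} (h : p.edgeRel a b c d) :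
    c ∈ p.dom ∨ (∃ s, c = tw φ s a) ∨ ∃ s, c = tw φ s b := by
  rcases h with h | ⟨s, h | h⟩
  · exact Or.inl ⟨d, h⟩
  · exact Or.inr (Or.inl ⟨s, h.1⟩)
  · exact Or.inr (Or.inr ⟨s, h.1⟩)

theorem edgeRel_self (p : State φ X) (a b : Pt X) : p.edgeRel a b a b :=
  Or.inr ⟨1, Or.inl ⟨(tw_one φ a).symm, (tw_one φ b).symm⟩⟩

theorem Fresh.notMem_dom {p : State φ X} {v : Pt X} (h : p.Fresh v) : v ∉ p.dom :=
  fun hv => h v hv (SameOrb.refl v)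

theorem Fresh.orb {p : State φ X} {v w : Pt X} (h : p.Fresh v) (ho : SameOrb (G := G) v w) :
    p.Fresh w :=
  fun y hy hyw => h y hy (hyw.trans ho.symm)

/-- A fresh orbit can be attached at any point out of the domain. -/
theorem exists_attach (H : FreePair φ X) (p : State φ X) {a : Pt X} {i : Fin 2} {v : X i}
    (ha : a ∉ p.dom) (hv : p.Fresh ⟨i, v⟩) (hi : a.1 ≠ i) :
    ∃ q : State φ X, p ≤ q ∧ q.rel a ⟨i, v⟩ ∧ q.rel = p.edgeRel a ⟨i, v⟩ := by
  -- The class of `h • v` stays unmatched: it is the exit of the components whose former exit was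
  -- used up by the new edge.
  obtain ⟨h, hh⟩ := H.proper i
  have hout : ∀ d, ¬ p.edgeRel a ⟨i, v⟩ ⟨i, h • v⟩ d := by
    intro d hd
    rcases edgeRel_dom hd with h1 | ⟨s, h1⟩ | ⟨s, h1⟩
    · exact hv _ h1 (SameOrb.mk i h v).symm
    · exact hi (congrArg Sigma.fst h1).symm
    · exact H.smul_ne_tw hh v s h1
  refine ⟨p.addEdge H a ⟨i, v⟩ ha hv.notMem_dom hi fun c => ?_, fun _ _ => Or.inl,
    p.edgeRel_self _ _, rfl⟩
  obtain ⟨e, he, hc⟩ := p.exit c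
  have hc' := hc.mono (r' := p.edgeRel a ⟨i, v⟩) fun _ _ => Or.inl
  have hvh : SameOrb (G := G) (⟨i, v⟩ : Pt X) ⟨i, h • v⟩ := SameOrb.mk i h v
  by_cases hea : ∃ s, e = tw φ s a
  · obtain ⟨s, rfl⟩ := hea
    exact ⟨_, hout, ((hc'.orb (SameOrb.tw φ s a).symm).rel (p.edgeRel_self _ _)).orb hvh⟩
  by_cases hev : ∃ s, e = tw φ s ⟨i, v⟩
  · obtain ⟨s, rfl⟩ := hev
    exact ⟨_, hout, (hc'.orb (SameOrb.tw φ s _).symm).orb hvh⟩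
  refine ⟨e, fun d hd => ?_, hc'⟩
  rcases edgeRel_dom hd with ⟨b, h1⟩ | h1 | h1
  · exact he b h1
  · exact hea h1
  · exact hev h1

end State

end Points

/-! ### Forcing and generic bijections. -/

section Forcing

open Monoid (PushoutI)

variable {G : Fin 2 → Type*} {S : Type*} [∀ j, Group (G j)] [Group S] {φ : ∀ j, S →* G j}
variable {X : Fin 2 → Type*} [∀ j, MulAction (G j) (X j)]

/-- The identification of both spaces with the first one. -/
def PA.proj (τ : PA φ X) : Pt X → X 0
  | ⟨0, x⟩ => x
  | ⟨1, y⟩ => τ.1.symm y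

theorem PA.action_of (τ : PA φ X) (j : Fin 2) (g : G j) :
    τ.action (PushoutI.of j g) = τ.factorHom j g := by
  rw [PA.action, PushoutI.lift_of]

theorem PA.action_base (τ : PA φ X) (s : S) :
    τ.action (PushoutI.base φ s) = τ.factorHom 0 (φ 0 s) := by
  rw [PA.action, PushoutI.lift_base]; rfl

theorem PA.proj_smul (τ : PA φ X) (j : Fin 2) (g : G j) (x : X j) :
    τ.proj ⟨j, g • x⟩ = τ.action (PushoutI.of j g) (τ.proj ⟨j, x⟩) := by
  rw [PA.action_of]
  match j, g, x with
  | 0, g, x => rfl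
  | 1, g, x =>
    change τ.1.symm (g • x) = τ.1.symm (g • τ.1 (τ.1.symm x))
    rw [Equiv.apply_symm_apply]

theorem PA.proj_tw (τ : PA φ X) (s : S) (a : Pt X) :
    τ.proj (tw φ s a) = τ.action (PushoutI.base φ s) (τ.proj a) := by
  rw [← PushoutI.of_apply_eq_base φ a.1 s]
  exact τ.proj_smul a.1 (φ a.1 s) a.2

theorem PA.proj_injective (τ : PA φ X) (j : Fin 2) :
    Function.Injective fun x : X j => τ.proj ⟨j, x⟩ := by
  fin_cases j
  · exact fun _ _ h => h
  · exact τ.1.symm.injective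

/-- The matching `p` is a part of the graph of `τ`. -/
def Extends (τ : PA φ X) (p : State φ X) : Prop := ∀ a b, p.rel a b → τ.proj a = τ.proj b

theorem Extends.mono {τ : PA φ X} {p q : State φ X} (h : Extends τ q) (hpq : p ≤ q) :
    Extends τ p := fun a b hab => h a b (hpq a b hab)

/-- Every `τ` that extends `p` satisfies `γ a = b`. -/
def Forces (p : State φ X) (γ : Amalgam φ) (a b : Pt X) : Prop :=
  ∀ τ : PA φ X, Extends τ p → τ.action γ (τ.proj a) = τ.proj b

theorem Forces.mono {p q : State φ X} {γ : Amalgam φ} {a b : Pt X} (h : Forces p γ a b)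
    (hpq : p ≤ q) : Forces q γ a b := fun τ hτ => h τ (hτ.mono hpq)

theorem Forces.one (p : State φ X) (a : Pt X) : Forces p 1 a a := fun τ _ => by simp

theorem Forces.mul {p : State φ X} {γ δ : Amalgam φ} {a b c : Pt X} (h : Forces p γ b c)
    (h' : Forces p δ a b) : Forces p (γ * δ) a c := fun τ hτ => by
  rw [map_mul, Equiv.Perm.mul_apply, h' τ hτ, h τ hτ]

theorem Forces.inv {p : State φ X} {γ : Amalgam φ} {a b : Pt X} (h : Forces p γ a b) :
    Forces p γ⁻¹ b a := fun τ hτ => by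
  rw [map_inv, Equiv.Perm.inv_eq_iff_eq, h τ hτ]

theorem Forces.smul (p : State φ X) {j : Fin 2} (g : G j) (x : X j) :
    Forces p (PushoutI.of j g) ⟨j, x⟩ ⟨j, g • x⟩ := fun τ _ => (τ.proj_smul j g x).symm

theorem Forces.tw (p : State φ X) (s : S) (a : Pt X) :
    Forces p (PushoutI.base φ s) a (tw φ s a) := fun τ _ => (τ.proj_tw s a).symm

theorem Forces.rel {p : State φ X} {a b : Pt X} (h : p.rel a b) : Forces p 1 a b :=
  fun τ hτ => by simpa using hτ a b h

theorem Forces.rel_smul {p : State φ X} {γ : Amalgam φ} {c a : Pt X} (h : Forces p γ c a)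
    {j : Fin 2} {v : X j} (hv : p.rel a ⟨j, v⟩) (g : G j) :
    Forces p (PushoutI.of j g * γ) c ⟨j, g • v⟩ := by
  simpa using ((Forces.smul p g v).mul (Forces.rel hv)).mul h

theorem State.exists_mem_dom (H : FreePair φ X) (p : State φ X) (a : Pt X) :
    ∃ q : State φ X, p ≤ q ∧ a ∈ q.dom := by
  by_cases ha : a ∈ p.dom
  · exact ⟨p, le_rfl, ha⟩
  obtain ⟨v, hv, -⟩ := p.exists_fresh H (Fin.rev a.1) Set.finite_empty
  obtain ⟨q, hpq, hq, -⟩ := p.exists_attach H ha hv (by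
    generalize a.1 = j; revert j; decide)
  exact ⟨q, hpq, _, hq⟩

/-- A generic element of the space, for countably many dense sets of states. -/
theorem exists_generic (H : FreePair φ X) [∀ j, Countable (X j)] {ι : Type*} [Countable ι]
    (𝒟 : ι → Set (State φ X)) (h𝒟 : ∀ i p, ∃ q ∈ 𝒟 i, p ≤ q) (p : State φ X) :
    ∃ τ : PA φ X, Extends τ p ∧ ∀ i, ∃ q ∈ 𝒟 i, Extends τ q := by
  classical
  have : Encodable (Pt X ⊕ ι) := Encodable.ofCountable _
  -- The requirements that a given point be matched are added to the list; they make the union of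
  -- the chain of states a bijection.
  let 𝒞 : Pt X ⊕ ι → Order.Cofinal (State φ X) := Sum.elim
    (fun a => ⟨{q | a ∈ q.dom}, fun p =>
      let ⟨q, h, h'⟩ := p.exists_mem_dom H a
      ⟨q, h', h⟩⟩)
    (fun i => ⟨𝒟 i, fun p => h𝒟 i p⟩)
  let f := Order.sequenceOfCofinals p 𝒞
  have hmono : Monotone f := Order.sequenceOfCofinals.monotone p 𝒞
  have hmem : ∀ i, ∃ n, f n ∈ 𝒞 i := fun i => ⟨_, Order.sequenceOfCofinals.encode_mem p 𝒞 i⟩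
  let R : Pt X → Pt X → Prop := fun a b => ∃ n, (f n).rel a b
  have hR : ∀ {a b c}, R a b → R a c → b = c := by
    rintro a b c ⟨n, hn⟩ ⟨m, hm⟩
    exact (f (max n m)).uniq (hmono (le_max_left n m) _ _ hn) (hmono (le_max_right n m) _ _ hm)
  have hRs : ∀ {a b}, R a b → R b a := fun ⟨n, hn⟩ => ⟨n, (f n).symm hn⟩
  have hR0 : ∀ x : X 0, ∃ y : X 1, R ⟨0, x⟩ ⟨1, y⟩ := fun x => by
    obtain ⟨n, hn⟩ := hmem (Sum.inl ⟨0, x⟩)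
    obtain ⟨y, hy⟩ := State.exists_rel (by decide : (1 : Fin 2) ≠ 0) hn
    exact ⟨y, n, hy⟩
  have hR1 : ∀ y : X 1, ∃ x : X 0, R ⟨1, y⟩ ⟨0, x⟩ := fun x => by
    obtain ⟨n, hn⟩ := hmem (Sum.inl ⟨1, x⟩)
    obtain ⟨y, hy⟩ := State.exists_rel (by decide : (0 : Fin 2) ≠ 1) hn
    exact ⟨y, n, hy⟩
  choose t ht using hR0
  choose u hu using hR1
  let τ : X 0 ≃ X 1 :=
    { toFun := t
      invFun := u
      left_inv := fun x => by simpa using hR (hu (t x)) (hRs (ht x))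
      right_inv := fun y => by simpa using hR (ht (u y)) (hRs (hu y)) }
  have hτ : ∀ (s : S) (x : X 0), τ (φ 0 s • x) = φ 1 s • τ x := fun s x => by
    obtain ⟨n, hn⟩ := ht x
    exact eq_of_heq (Sigma.mk.inj (hR (ht (φ 0 s • x)) ⟨n, (f n).twist s hn⟩)).2
  have key : ∀ n, Extends (⟨τ, hτ⟩ : PA φ X) (f n) := by
    have h01 : ∀ (x : X 0) (y : X 1), R ⟨0, x⟩ ⟨1, y⟩ →
        PA.proj (⟨τ, hτ⟩ : PA φ X) ⟨0, x⟩ = PA.proj (⟨τ, hτ⟩ : PA φ X) ⟨1, y⟩ := fun x y h => by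
      change x = u y
      simpa using hR (hRs h) (hu y)
    rintro n ⟨i, x⟩ ⟨j, y⟩ h
    have hij : i ≠ j := (f n).fiber h
    obtain ⟨rfl, rfl⟩ | ⟨rfl, rfl⟩ : (i = 0 ∧ j = 1) ∨ (i = 1 ∧ j = 0) := by omega
    · exact h01 x y ⟨n, h⟩
    · exact (h01 y x ⟨n, (f n).symm h⟩).symm
  refine ⟨⟨τ, hτ⟩, key 0, fun i => ?_⟩
  obtain ⟨n, hn⟩ := hmem (Sum.inr i)
  exact ⟨f n, hn, key n⟩

theorem exists_extends (H : FreePair φ X) [∀ j, Countable (X j)] (p : State φ X) :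
    ∃ τ : PA φ X, Extends τ p :=
  let ⟨τ, h, _⟩ := exists_generic H (fun i : Empty => i.elim) (fun i => i.elim) p
  ⟨τ, h⟩

/-- A state is a part of the graph of some `τ`, whose action is by bijections. -/
theorem Forces.unique (H : FreePair φ X) [∀ j, Countable (X j)] {p : State φ X}
    {γ : Amalgam φ} {j : Fin 2} {x y : X j} {b : Pt X} (h : Forces p γ ⟨j, x⟩ b)
    (h' : Forces p γ ⟨j, y⟩ b) : x = y := by
  obtain ⟨τ, hτ⟩ := exists_extends H p
  exact τ.proj_injective j ((τ.action γ).injective ((h τ hτ).trans (h' τ hτ).symm))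

end Forcing

/-! ### Walking out of a finite matching without backtracking. -/

section Escape

variable {G : Fin 2 → Type*} {S : Type*} [∀ j, Group (G j)] [Group S] {φ : ∀ j, S →* G j}
variable {X : Fin 2 → Type*} [∀ j, MulAction (G j) (X j)]

/-- The successors of a directed edge, in a path without backtracking. -/
def State.Succ (p : State φ X) (d e : Pt X) : Prop :=
  ∃ (i : Fin 2) (g : G i) (v : X i), g ∉ (φ i).range ∧ p.rel d ⟨i, v⟩ ∧ e = ⟨i, g • v⟩

theorem State.Succ.twist {p : State φ X} {d e : Pt X} (h : p.Succ d e) (s : S) :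
    p.Succ d (tw φ s e) := by
  obtain ⟨i, g, v, hg, hr, rfl⟩ := h
  refine ⟨i, φ i s * g, v, fun hs => hg ?_, hr, by rw [tw_mk, mul_smul]⟩
  exact ((φ i).range.mul_mem_cancel_left ⟨s, rfl⟩).1 hs

variable (φ X) in
/-- The classes of points under the common subgroup. -/
def twSetoid : Setoid (Pt X) where
  r a b := ∃ s, a = tw φ s b
  iseqv :=
    { refl := fun a => ⟨1, (tw_one φ a).symm⟩
      symm := exists_tw_symm φ
      trans := exists_tw_trans φ }

/-- A set of directed edges that is closed under successors, in the domain of a finite matching,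
is closed under predecessors as well; so it consists of whole components. -/
theorem State.exists_succ_notMem_dom (H : FreePair φ X)
    (hw : ∀ i j : Fin 2, i ≠ j → Wide φ i ∨ Wide φ j) (p : State φ X) {R : Set (Pt X)}
    (hne : R.Nonempty) (htw : ∀ d ∈ R, ∀ s, tw φ s d ∈ R)
    (hsucc : ∀ d ∈ R, ∀ e, p.Succ d e → e ∈ R) : ∃ e ∈ R, e ∉ p.dom := by
  classical
  by_contra! hR
  let Q := Quotient (twSetoid φ X)
  let cls : Pt X → Q := Quotient.mk (twSetoid φ X)
  have hcls : ∀ {a b}, cls a = cls b ↔ ∃ s, a = tw φ s b := Quotient.eq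
  have htw' : ∀ {a b}, (∃ s, a = tw φ s b) → b ∈ R → a ∈ R := by
    rintro a b ⟨s, rfl⟩ hb
    exact htw b hb s
  have hfin : (cls '' R).Finite := by
    obtain ⟨D, hD, h⟩ := p.fin
    refine (hD.image cls).subset ?_
    rintro _ ⟨a, ha, rfl⟩
    obtain ⟨b, hb⟩ := hR a ha
    obtain ⟨s, d, hd, rfl⟩ := h a b hb
    exact ⟨d, hd, hcls.2 (exists_tw_symm φ ⟨s, rfl⟩)⟩
  choose g₀ hg₀ using H.proper
  choose! θ hθ using hR
  -- The far end `b` of an edge of `R` is brought back into `R`: it is kept if its whole orbit lies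
  -- in `R`, and otherwise replaced by a successor in the same orbit. The map induced on the
  -- finitely many classes of `R` is injective, hence bijective.
  let ψ : Pt X → Pt X := fun b =>
    if ∀ y, SameOrb (G := G) b y → y ∈ R then b else ⟨b.1, g₀ b.1 • b.2⟩
  have hψorb : ∀ b, SameOrb (G := G) b (ψ b) := fun b => by
    by_cases h : ∀ y, SameOrb (G := G) b y → y ∈ R
    · simp only [ψ, if_pos h]; exact SameOrb.refl b
    · simp only [ψ, if_neg h]; exact SameOrb.mk b.1 _ b.2
  -- in an orbit that is not contained in `R`, there is one incoming class
  have hout : ∀ {d b y}, d ∈ R → p.rel d b → SameOrb (G := G) b y → y ∉ R →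
      ∃ s, y = tw φ s b := by
    intro d b y hd hdb hby hy
    obtain ⟨i, g, v⟩ := hby
    by_cases hg : g ∈ (φ i).range
    · obtain ⟨s, rfl⟩ := hg
      exact ⟨s, rfl⟩
    · exact absurd (hsucc d hd _ ⟨i, g, v, hg, hdb, rfl⟩) hy
  have hψR : ∀ d ∈ R, ψ (θ d) ∈ R := fun d hd => by
    by_cases h : ∀ y, SameOrb (G := G) (θ d) y → y ∈ R
    · simp only [ψ, if_pos h]; exact h _ (SameOrb.refl _)
    · simp only [ψ, if_neg h]
      exact hsucc d hd _ ⟨_, _, _, hg₀ _, hθ d hd, rfl⟩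
  have houtR : ∀ q : Q, q ∈ cls '' R → q.out ∈ R := by
    rintro _ ⟨a, ha, rfl⟩
    exact htw' (hcls.1 (Quotient.out_eq (cls a))) ha
  have hinj0 : ∀ d ∈ R, ∀ d' ∈ R, (∃ s, θ d = tw φ s (θ d')) →
      ∃ s, d = tw φ s d' := by
    rintro d hd d' hd' ⟨s, hs⟩
    exact ⟨s, p.uniq (p.symm (hθ d hd)) (hs ▸ p.symm (p.twist s (hθ d' hd')))⟩
  have hthin : ∀ d ∈ R, ∀ d' ∈ R, SameOrb (G := G) (θ d) (θ d') →
      (¬ ∀ y, SameOrb (G := G) (θ d) y → y ∈ R) → ∃ s, θ d = tw φ s (θ d') := by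
    intro d hd d' hd' ho hn
    push Not at hn
    obtain ⟨y, hy, hyR⟩ := hn
    exact exists_tw_trans φ (exists_tw_symm φ (hout hd (hθ d hd) hy hyR))
      (hout hd' (hθ d' hd') (ho.symm.trans hy) hyR)
  let Ψ : Q → Q := fun q => cls (ψ (θ q.out))
  have hmaps : Set.MapsTo Ψ (cls '' R) (cls '' R) := fun q hq =>
    ⟨_, hψR _ (houtR q hq), rfl⟩
  have hinj : Set.InjOn Ψ (cls '' R) := by
    intro q hq q' hq' e
    have hd := houtR q hq
    have hd' := houtR q' hq'
    suffices h : ∃ s, q.out = tw φ s q'.out by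
      rw [← Quotient.out_eq q, ← Quotient.out_eq q']
      exact hcls.2 h
    refine hinj0 _ hd _ hd' ?_
    obtain ⟨s, hs⟩ := hcls.1 e
    have ho : SameOrb (G := G) (θ q.out) (θ q'.out) := by
      have h1 := hψorb (θ q.out)
      rw [hs] at h1
      exact (h1.trans (SameOrb.tw φ s _).symm).trans (hψorb _).symm
    by_cases h : ∀ y, SameOrb (G := G) (θ q.out) y → y ∈ R
    · have h' : ∀ y, SameOrb (G := G) (θ q'.out) y → y ∈ R := fun y hy => h y (ho.trans hy)
      simp only [ψ, if_pos h, if_pos h'] at hs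
      exact ⟨s, hs⟩
    · exact hthin _ hd _ hd' ho h
  have hsurj : ∀ y ∈ R, ∃ q ∈ cls '' R, ∃ s, y = tw φ s (ψ (θ q.out)) := by
    intro y hy
    have := hfin.to_subtype
    obtain ⟨⟨q, hq⟩, e⟩ := Finite.surjective_of_injective (hmaps.restrict_inj.2 hinj)
      ⟨cls y, y, hy, rfl⟩
    exact ⟨q, hq, hcls.1 (congrArg Subtype.val e).symm⟩
  -- In an orbit contained in `R` the map does not move far ends, so surjectivity says that every
  -- class of it is entered by an edge of `R`.
  have hsurj' : ∀ y ∈ R, (∀ z, SameOrb (G := G) y z → z ∈ R) → ∃ d ∈ R, p.rel d y := by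
    intro y hy hall
    obtain ⟨q, hq, s, e⟩ := hsurj y hy
    have ho : SameOrb (G := G) y (θ q.out) := by
      rw [e]
      exact (SameOrb.tw φ s _).symm.trans (hψorb _).symm
    have h : ∀ z, SameOrb (G := G) (θ q.out) z → z ∈ R := fun z hz => hall z (ho.trans hz)
    simp only [ψ, if_pos h] at e
    refine ⟨_, htw _ (houtR q hq) s, ?_⟩
    rw [e]
    exact p.twist s (hθ _ (houtR q hq))
  -- An orbit of a wide factor that meets `R` lies in `R`. Otherwise it has a single incoming class
  -- and hence a single class in the image of the bijection, but at least two classes of successors.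
  have hwide : ∀ y ∈ R, Wide φ y.1 → ∀ z, SameOrb (G := G) y z → z ∈ R ∧ ∃ d ∈ R, p.rel d z := by
    intro y hy hyw
    suffices hall : ∀ z, SameOrb (G := G) y z → z ∈ R from fun z hz =>
      ⟨hall z hz, hsurj' z (hall z hz) fun w hw => hall w (hz.trans hw)⟩
    obtain ⟨q, hq, s, e⟩ := hsurj y hy
    have hd := houtR q hq
    have ho : SameOrb (G := G) y (θ q.out) := by
      rw [e]
      exact (SameOrb.tw φ s _).symm.trans (hψorb _).symm
    by_contra hn
    have hn' : ¬ ∀ z, SameOrb (G := G) (θ q.out) z → z ∈ R := fun h =>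
      hn fun z hz => h z (ho.symm.trans hz)
    rw [ho.fst] at hyw
    obtain ⟨g, hg, hg'⟩ := hyw (g₀ _)
    have hz := hsucc _ hd _ ⟨_, g, _, hg, hθ _ hd, rfl⟩
    obtain ⟨q', hq', t, e'⟩ := hsurj _ hz
    have ho' : SameOrb (G := G) (θ q.out) (θ q'.out) := by
      refine (SameOrb.mk _ g _).trans ?_
      rw [e']
      exact (SameOrb.tw φ t _).symm.trans (hψorb _).symm
    have hqq : q = q' := by
      rw [← Quotient.out_eq q, ← Quotient.out_eq q']
      exact hcls.2 (hinj0 _ hd _ (houtR q' hq') (hthin _ hd _ (houtR q' hq') ho' hn'))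
    subst hqq
    simp only [ψ, if_neg hn', tw_mk, Sigma.mk.injEq, heq_eq_eq, true_and] at e'
    rw [← mul_smul] at e'
    exact hg' ⟨t, by rw [H.smul_inj e', mul_inv_cancel_right]⟩
  -- The edges of `R` whose reversal is also in `R`. Each edge has an end in an orbit of a wide
  -- factor, so this is all of `R`, which is therefore closed under all moves and contains an exit.
  let M : Set (Pt X) := {a | a ∈ R ∧ ∃ d ∈ R, p.rel d a}
  have hedge : ∀ y ∈ R, ∀ b, p.rel y b → y ∈ M ∨ b ∈ M := by
    intro y hy b hb
    rcases hw _ _ (p.fiber hb) with h | h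
    · exact Or.inl (hwide y hy h y (SameOrb.refl y))
    · exact Or.inr (hwide _ (hsucc y hy ⟨b.1, g₀ b.1 • b.2⟩ ⟨_, _, _, hg₀ _, hb, rfl⟩) h b
        (SameOrb.mk _ _ _).symm)
  have hrel : ∀ a ∈ M, ∀ b, p.rel a b → b ∈ M := by
    rintro a ⟨ha, d, hd, hda⟩ b hb
    obtain rfl := p.uniq (p.symm hda) hb
    exact ⟨hd, a, ha, hb⟩
  have hM : ∀ y ∈ R, y ∈ M := by
    intro y hy
    rcases hedge y hy _ (hθ y hy) with h | h
    · exact h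
    · exact hrel _ h _ (p.symm (hθ y hy))
  have horb : ∀ a ∈ M, ∀ b, SameOrb (G := G) a b → b ∈ M := by
    rintro a ⟨ha, d, hd, hda⟩ b hb
    refine hM b ?_
    by_contra hbR
    exact hbR (htw' (hout hd hda hb hbR) ha)
  obtain ⟨c, hc⟩ := hne
  obtain ⟨e, he, hce⟩ := p.exit c
  have heM : e ∈ M := by
    clear he
    induction hce with
    | refl => exact hM c hc
    | tail _ h ih => exact h.elim (hrel _ ih _) (horb _ ih _)
  exact he _ (hθ e heM.1)

/-- The set of all proper descendants of `c` is non-empty, stable under Σ and closed under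
successors. -/
theorem State.exists_reach_notMem_dom (H : FreePair φ X)
    (hw : ∀ i j : Fin 2, i ≠ j → Wide φ i ∨ Wide φ j) (p : State φ X) {c : Pt X}
    (hc : c ∈ p.dom) : ∃ e ∉ p.dom, Relation.TransGen p.Succ c e := by
  obtain ⟨⟨i, v⟩, hv⟩ := hc
  obtain ⟨g, hg⟩ := H.proper i
  obtain ⟨e, he, he'⟩ := p.exists_succ_notMem_dom H hw (R := {e | Relation.TransGen p.Succ c e})
    ⟨_, Relation.TransGen.single ⟨i, g, v, hg, hv, rfl⟩⟩ (fun d hd s => by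
      cases hd with
      | single h => exact .single (h.twist s)
      | tail h h' => exact .tail h (h'.twist s)) fun d hd e he => .tail hd he
  exact ⟨e, he', he⟩

end Escape

/-! ### Simultaneous displacement of finitely many points. -/

section Configurations

open Monoid (PushoutI)

variable {G : Fin 2 → Type*} {S : Type*} [∀ j, Group (G j)] [Group S] {φ : ∀ j, S →* G j}
variable {X : Fin 2 → Type*} [∀ j, MulAction (G j) (X j)]

theorem State.Fresh.mono {p q : State φ X} (h : p ≤ q) {v : Pt X} (hv : q.Fresh v) :
    p.Fresh v := fun y hy => hv y (dom_mono h hy)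

theorem State.Fresh.twist {p : State φ X} {v : Pt X} (hv : p.Fresh v) (s : S) :
    p.Fresh (tw φ s v) := hv.orb (SameOrb.tw φ s v)

/-- A matching can be extended to finitely many points by attaching fresh orbits. -/
theorem State.exists_step (H : FreePair φ X) (p : State φ X) {i j : Fin 2} (hij : i ≠ j)
    (U : Finset (X j)) : ∃ q : State φ X, p ≤ q ∧ (∀ u ∈ U, (⟨j, u⟩ : Pt X) ∈ q.dom) ∧
      (∀ u ∈ U, (⟨j, u⟩ : Pt X) ∉ p.dom → ∀ v : X i, q.rel ⟨j, u⟩ ⟨i, v⟩ →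
        p.Fresh ⟨i, v⟩ ∧ ∀ y ∈ q.dom, SameOrb (G := G) y ⟨i, v⟩ → ∃ s, y = tw φ s ⟨i, v⟩) ∧
      (∀ y ∈ q.dom, y ∈ p.dom ∨ (∃ u ∈ U, (⟨j, u⟩ : Pt X) ∉ p.dom ∧ ∃ s, y = tw φ s ⟨j, u⟩) ∨
        (y.1 = i ∧ p.Fresh y)) := by
  classical
  induction U using Finset.induction_on with
  | empty => exact ⟨p, le_rfl, by simp, by simp, fun y hy => Or.inl hy⟩
  | insert u U _ ih =>
    obtain ⟨q, hpq, h1, h2, h3⟩ := ih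
    by_cases hu : (⟨j, u⟩ : Pt X) ∈ q.dom
    · refine ⟨q, hpq, ?_, ?_, ?_⟩
      · rintro w hw
        rcases Finset.mem_insert.1 hw with rfl | hw
        exacts [hu, h1 w hw]
      · intro w hw hwp v hv
        rcases Finset.mem_insert.1 hw with rfl | hw
        · rcases h3 _ hu with h | ⟨w', hw', hwp', s, hs⟩ | ⟨h, -⟩
          · exact absurd h hwp
          -- Here `w` was matched together with the Σ-class of an earlier point `w'`, so its fresh
          -- orbit is that of `w'`, up to a translation by `s`.
          · have hr : q.rel ⟨j, w'⟩ ⟨i, φ i s⁻¹ • v⟩ := by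
              have := q.twist s⁻¹ hv
              rwa [hs, tw_inv_tw] at this
            obtain ⟨hf, hd⟩ := h2 w' hw' hwp' _ hr
            have e : (⟨i, v⟩ : Pt X) = tw φ s ⟨i, φ i s⁻¹ • v⟩ := by
              rw [← tw_mk, tw_tw_inv]
            refine ⟨?_, fun y hy hyv => ?_⟩
            · rw [e]; exact hf.twist s
            · refine exists_tw_trans φ (hd y hy (hyv.trans ?_)) ⟨s⁻¹, tw_mk φ _ _ _⟩
              exact SameOrb.mk i _ v
          · exact absurd h hij.symm
        · exact h2 w hw hwp v hv
      · intro y hy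
        rcases h3 y hy with h | ⟨w', hw', h⟩ | h
        · exact Or.inl h
        · exact Or.inr (Or.inl ⟨w', Finset.mem_insert_of_mem hw', h⟩)
        · exact Or.inr (Or.inr h)
    obtain ⟨v, hv, -⟩ := q.exists_fresh H i Set.finite_empty
    obtain ⟨r, hqr, hr, hre⟩ := q.exists_attach H hu hv hij.symm
    have hdom : ∀ y ∈ r.dom, y ∈ q.dom ∨ (∃ s, y = tw φ s ⟨j, u⟩) ∨
        ∃ s, y = tw φ s ⟨i, v⟩ := by
      rintro y ⟨z, hz⟩
      rw [hre] at hz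
      exact edgeRel_dom hz
    refine ⟨r, hpq.trans hqr, ?_, ?_, ?_⟩
    · rintro w hw
      rcases Finset.mem_insert.1 hw with rfl | hw
      exacts [⟨_, hr⟩, dom_mono hqr (h1 w hw)]
    · intro w hw hwp v' hv'
      rcases Finset.mem_insert.1 hw with rfl | hw
      · obtain rfl : v' = v := by simpa using r.uniq hv' hr
        refine ⟨hv.mono hpq, fun y hy hyv => ?_⟩
        rcases hdom y hy with h | ⟨s, rfl⟩ | h
        · exact absurd hyv (hv y h)
        · exact absurd hyv.fst hij.symm
        · exact h
      · obtain ⟨v'', hv''⟩ := exists_rel hij (h1 w hw)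
        obtain rfl : v' = v'' := by simpa using r.uniq hv' (hqr _ _ hv'')
        obtain ⟨hf, hd⟩ := h2 w hw hwp v' hv''
        refine ⟨hf, fun y hy hyv => ?_⟩
        rcases hdom y hy with h | ⟨s, rfl⟩ | ⟨s, rfl⟩
        · exact hd y h hyv
        · exact absurd hyv.fst hij.symm
        · exact absurd (hyv.symm.trans (SameOrb.tw φ s _).symm) (hv _ (right_mem_dom hv''))
    · intro y hy
      rcases hdom y hy with h | h | ⟨s, rfl⟩
      · rcases h3 y h with h | ⟨w', hw', h⟩ | h
        · exact Or.inl h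
        · exact Or.inr (Or.inl ⟨w', Finset.mem_insert_of_mem hw', h⟩)
        · exact Or.inr (Or.inr h)
      · by_cases hup : (⟨j, u⟩ : Pt X) ∈ p.dom
        · exact absurd (dom_mono hpq hup) hu
        · exact Or.inr (Or.inl ⟨u, Finset.mem_insert_self _ _, hup, h⟩)
      · exact Or.inr (Or.inr ⟨rfl, (hv.mono hpq).twist s⟩)

variable {ι : Type*}

/-- A simultaneous displacement by `γ` of the points `x k`, such that those with index in `Z`
arrive out of the domain of `p`, in distinct classes. -/
structure IsConfig (x : ι → X 0) (p : State φ X) (γ : Amalgam φ) (j : Fin 2) (pos : ι → X j)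
    (Z : Finset ι) : Prop where
  forces : ∀ k, Forces p γ ⟨0, x k⟩ ⟨j, pos k⟩
  out : ∀ k ∈ Z, (⟨j, pos k⟩ : Pt X) ∉ p.dom
  indep : ∀ k ∈ Z, ∀ l ∈ Z, (∃ s, (⟨j, pos k⟩ : Pt X) = tw φ s ⟨j, pos l⟩) → k = l

namespace IsConfig

variable {x : ι → X 0} {p : State φ X} {γ : Amalgam φ} {j : Fin 2} {pos : ι → X j}
  {Z : Finset ι}

/-- One letter of a walk. Unmatched positions are attached to fresh orbits, in which only the class
of entry is matched; as `h` is not in Σ, it moves them to another class, which is unmatched. Two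
freed points in the same fresh orbit would have entered it by the same class, so independence
persists. Captive points just follow the existing edges. -/
theorem step [Fintype ι] (H : FreePair φ X) (C : IsConfig x p γ j pos Z) {i : Fin 2}
    (hij : i ≠ j) {h : G i} (hh : h ∉ (φ i).range) :
    ∃ (q : State φ X) (v : ι → X i), p ≤ q ∧
      IsConfig x q (PushoutI.of i h * γ) i (fun k => h • v k) Z ∧
      (∀ k, q.rel ⟨j, pos k⟩ ⟨i, v k⟩) ∧
      (∀ k, (⟨j, pos k⟩ : Pt X) ∉ p.dom → p.Fresh ⟨i, v k⟩ ∧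
        ∀ y ∈ q.dom, SameOrb (G := G) y ⟨i, v k⟩ → ∃ s, y = tw φ s ⟨i, v k⟩) ∧
      (∀ y ∈ q.dom, y ∈ p.dom ∨
        (∃ k, (⟨j, pos k⟩ : Pt X) ∉ p.dom ∧ ∃ s, y = tw φ s ⟨j, pos k⟩) ∨ p.Fresh y) := by
  classical
  obtain ⟨q, hpq, h1, h2, h3⟩ := p.exists_step H hij (Finset.univ.image pos)
  have hmem : ∀ k, pos k ∈ Finset.univ.image pos := fun k =>
    Finset.mem_image_of_mem _ (Finset.mem_univ k)
  choose v hv using fun k => State.exists_rel hij (h1 _ (hmem k))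
  have h2' : ∀ k, (⟨j, pos k⟩ : Pt X) ∉ p.dom → p.Fresh ⟨i, v k⟩ ∧
      ∀ y ∈ q.dom, SameOrb (G := G) y ⟨i, v k⟩ → ∃ s, y = tw φ s ⟨i, v k⟩ := fun k hk =>
    h2 _ (hmem k) hk _ (hv k)
  refine ⟨q, v, hpq, ⟨fun k => ((C.forces k).mono hpq).rel_smul (hv k) h, fun k hk hd => ?_,
    fun k hk l hl e => ?_⟩, hv, h2', fun y hy => ?_⟩
  · obtain ⟨s, hs⟩ := (h2' k (C.out k hk)).2 _ hd (SameOrb.mk i h _).symm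
    exact H.smul_ne_tw hh _ s hs
  · obtain ⟨s, hs⟩ := e
    have ho : SameOrb (G := G) (⟨i, v k⟩ : Pt X) ⟨i, v l⟩ := by
      have h1 := SameOrb.mk i h (v k)
      rw [hs] at h1
      exact (h1.trans (SameOrb.tw φ s _).symm).trans (SameOrb.mk i h _).symm
    obtain ⟨t, ht⟩ := (h2' l (C.out l hl)).2 _ (State.right_mem_dom (hv k)) ho
    refine C.indep k hk l hl ⟨t, ?_⟩
    exact q.uniq (q.symm (hv k)) (ht ▸ q.symm (q.twist t (hv l)))
  · rcases h3 y hy with h | ⟨u, hu, h⟩ | h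
    · exact Or.inl h
    · obtain ⟨k, -, rfl⟩ := Finset.mem_image.1 hu
      exact Or.inr (Or.inl ⟨k, h⟩)
    · exact Or.inr (Or.inr h.2)

theorem insert_mem [DecidableEq ι] (C : IsConfig x p γ j pos Z) {c : ι}
    (hc : (⟨j, pos c⟩ : Pt X) ∉ p.dom)
    (hi : ∀ z ∈ Z, ¬ ∃ s, (⟨j, pos c⟩ : Pt X) = tw φ s ⟨j, pos z⟩) :
    IsConfig x p γ j pos (insert c Z) where
  forces := C.forces
  out k hk := by
    rcases Finset.mem_insert.1 hk with rfl | hk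
    exacts [hc, C.out k hk]
  indep k hk l hl e := by
    rcases Finset.mem_insert.1 hk with rfl | hk' <;> rcases Finset.mem_insert.1 hl with rfl | hl'
    · rfl
    · exact absurd e (hi l hl')
    · exact absurd (exists_tw_symm φ e) (hi k hk')
    · exact C.indep k hk' l hl' e

end IsConfig

variable (φ) in
/-- Some path without backtracking that starts in a coset of the factor `i` conjugates `s` out of
the common subgroup. -/
inductive Sep : Fin 2 → S → Prop
  | here (i : Fin 2) (s : S) (h : G i) (hh : h ∉ (φ i).range)
      (hs : h * φ i s * h⁻¹ ∉ (φ i).range) : Sep i s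
  | there (i j : Fin 2) (hij : i ≠ j) (s t : S) (h : G i) (hh : h ∉ (φ i).range)
      (hs : h * φ i s * h⁻¹ = φ i t) (ht : Sep j t) : Sep i s

/-- While `c` and `z` sit in the same Σ-class and differ by `s`, they walk through the same fresh
orbits, and a letter `h` changes the difference into its conjugate by `h`. The walk given by `Sep`
ends when this conjugate leaves Σ. -/
theorem IsConfig.separate [Fintype ι] [DecidableEq ι] (H : FreePair φ X) {x : ι → X 0}
    {Z : Finset ι} {z c : ι} (hz : z ∈ Z) {i : Fin 2} {s : S}
    (hs : Sep φ i s) : ∀ {p : State φ X} {γ : Amalgam φ} {j : Fin 2} {pos : ι → X j},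
    IsConfig x p γ j pos Z → i ≠ j → (⟨j, pos c⟩ : Pt X) = tw φ s ⟨j, pos z⟩ →
    ∃ (q : State φ X) (δ : Amalgam φ) (l : Fin 2) (pos' : ι → X l), p ≤ q ∧
      IsConfig x q δ l pos' (insert c Z) := by
  induction hs with
  | here i s h hh hs =>
    intro p γ j pos C hij e
    obtain ⟨q, v, hpq, C', hv, hf, -⟩ := C.step H hij hh
    have hvc : v c = φ i s • v z := by
      have := q.uniq (hv c) (e ▸ q.twist s (hv z))
      simpa [tw_mk] using this
    refine ⟨q, _, i, _, hpq, C'.insert_mem (c := c) (fun hd => ?_) ?_⟩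
    · have hc : (⟨j, pos c⟩ : Pt X) ∉ p.dom := by
        rw [e]; exact (State.tw_mem_dom_iff s).not.2 (C.out z hz)
      obtain ⟨t, ht⟩ := (hf c hc).2 _ hd (SameOrb.mk i h _).symm
      exact H.smul_ne_tw hh _ t ht
    · rintro w hw ⟨t, ht⟩
      have ho : SameOrb (G := G) (⟨i, v w⟩ : Pt X) ⟨i, v z⟩ := by
        refine (SameOrb.mk i h _).trans ((SameOrb.tw φ t _).trans ?_)
        rw [← ht, hvc, ← mul_smul]
        exact (SameOrb.mk i _ _).symm
      obtain ⟨r, hr⟩ := (hf z (C.out z hz)).2 _ (State.right_mem_dom (hv w)) ho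
      have hwz : w = z := C.indep w hw z hz
        ⟨r, q.uniq (q.symm (hv w)) (hr ▸ q.symm (q.twist r (hv z)))⟩
      subst hwz
      simp only [hvc, tw_mk, Sigma.mk.injEq, heq_eq_eq, true_and, ← mul_smul] at ht
      have := H.smul_inj ht
      exact hs ⟨t, by rw [this, mul_inv_cancel_right]⟩
  | there i l hil s t h hh hs _ ih =>
    intro p γ j pos C hij e
    obtain ⟨q, v, hpq, C', hv, -, -⟩ := C.step H hij hh
    have hvc : v c = φ i s • v z := by
      have := q.uniq (hv c) (e ▸ q.twist s (hv z))
      simpa [tw_mk] using this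
    obtain ⟨r, δ, l', pos', hqr, C''⟩ := ih C' hil.symm (by
      simp only [hvc, tw_mk, Sigma.mk.injEq, heq_eq_eq, true_and, ← hs, ← mul_smul]
      simp [mul_assoc])
    exact ⟨r, δ, l', pos', hpq.trans hqr, C''⟩

end Configurations

/-! ### Freeing the captive points one by one. -/

section Displacement

open Monoid (PushoutI)

variable {G : Fin 2 → Type*} {S : Type*} [∀ j, Group (G j)] [Group S] {φ : ∀ j, S →* G j}
variable {X : Fin 2 → Type*} [∀ j, MulAction (G j) (X j)]
variable {ι : Type*} [Fintype ι]

/-- A configuration at a point with a successor can be moved along a path without backtracking, if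
all its independent families keep the index set `Z`. -/
theorem IsConfig.follow (H : FreePair φ X) {x : ι → X 0} {Z : Finset ι} {p : State φ X}
    {i : Fin 2} {γ : Amalgam φ} {pos : ι → X i} (C : IsConfig x p γ i pos Z)
    (hdom : ∀ (q : State φ X) (δ : Amalgam φ) (l : Fin 2) (pos' : ι → X l), p ≤ q →
      IsConfig x q δ l pos' Z → ∀ k ∉ Z, (⟨l, pos' k⟩ : Pt X) ∈ q.dom)
    (c : ι) {d : Pt X} (hd : Relation.ReflTransGen p.Succ ⟨i, pos c⟩ d) :
    ∃ (q : State φ X) (δ : Amalgam φ) (l : Fin 2) (pos' : ι → X l), p ≤ q ∧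
      IsConfig x q δ l pos' Z ∧ (⟨l, pos' c⟩ : Pt X) = d ∧
      (∀ z ∈ Z, (⟨l, pos' z⟩ : Pt X) = ⟨i, pos z⟩ ∨ p.Fresh ⟨l, pos' z⟩) ∧
      ∀ y ∈ q.dom, y ∈ p.dom ∨ (∃ z ∈ Z, ∃ s, y = tw φ s ⟨i, pos z⟩) ∨ p.Fresh y := by
  induction hd with
  | refl => exact ⟨p, γ, i, pos, le_rfl, C, rfl, fun z _ => Or.inl rfl, fun y hy => Or.inl hy⟩
  | tail _ hs ih =>
    obtain ⟨q, δ, l, pos', hpq, C', hc, hZ, hq⟩ := ih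
    obtain ⟨m, g, v, hg, hr, rfl⟩ := hs
    rw [← hc] at hr
    obtain ⟨r, w, hqr, C'', hw, hf, hr'⟩ := C'.step H (p.fiber hr).symm hg
    have hwc : w c = v := by simpa using r.uniq (hw c) (hqr _ _ (hpq _ _ hr))
    refine ⟨r, _, m, _, hpq.trans hqr, C'', by simp only [hwc], fun z hz => Or.inr ?_, fun y hy => ?_⟩
    · exact ((hf z (C'.out z hz)).1.mono hpq).orb (SameOrb.mk m g _)
    · rcases hr' y hy with h | ⟨k, hk, s, rfl⟩ | h
      · exact hq y h
      · have hkZ : k ∈ Z := by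
          by_contra hkZ
          exact hk (hdom q _ _ _ hpq C' k hkZ)
        rcases hZ k hkZ with h | h
        · exact Or.inr (Or.inl ⟨k, hkZ, s, by rw [h]⟩)
        · exact Or.inr (Or.inr (h.twist s))
      · exact Or.inr (Or.inr (h.mono hpq))

/-- Argument by maximality: if no larger set of indices can be freed, a captive point stays captive
in every later configuration, yet it can be walked out of the domain. -/
theorem IsConfig.improve_of_wide [∀ j, Countable (X j)] (H : FreePair φ X)
    (hw : ∀ i j : Fin 2, i ≠ j → Wide φ i ∨ Wide φ j)
    (hsep : ∀ s : S, s ≠ 1 → ∀ i, Sep φ i s) {x : ι → X 0} (hx : Function.Injective x)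
    {Z : Finset ι} (hZ : Z ≠ Finset.univ) {p : State φ X} {j : Fin 2} {γ : Amalgam φ}
    {pos : ι → X j} (C : IsConfig x p γ j pos Z) {i : Fin 2} (hij : i ≠ j) (hi : Wide φ i) :
    ∃ (q : State φ X) (δ : Amalgam φ) (l : Fin 2) (pos' : ι → X l) (Z' : Finset ι), p ≤ q ∧
      IsConfig x q δ l pos' Z' ∧ Z.card < Z'.card := by
  classical
  by_contra! hmax
  obtain ⟨c, hcZ⟩ : ∃ c, c ∉ Z := by
    by_contra! h
    exact hZ (Finset.eq_univ_iff_forall.2 h)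
  have hdom : ∀ (q : State φ X) (δ : Amalgam φ) (l : Fin 2) (pos' : ι → X l), p ≤ q →
      IsConfig x q δ l pos' Z → ∀ k ∉ Z, (⟨l, pos' k⟩ : Pt X) ∈ q.dom := by
    intro q δ l pos' hpq C' k hk
    by_contra hkd
    have hlt : Z.card < (insert k Z).card := by
      rw [Finset.card_insert_of_notMem hk]; exact Nat.lt_succ_self _
    by_cases h : ∃ z ∈ Z, ∃ s, (⟨l, pos' k⟩ : Pt X) = tw φ s ⟨l, pos' z⟩
    · obtain ⟨z, hz, s, hs⟩ := h
      -- Two distinct initial points cannot be forced by the same element to the same place.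
      have hs1 : s ≠ 1 := by
        rintro rfl
        rw [tw_one] at hs
        have := C'.forces z
        rw [← hs] at this
        exact hk (hx ((C'.forces k).unique H this) ▸ hz)
      obtain ⟨r, δ', l', pos'', hqr, C''⟩ :=
        C'.separate H hz (hsep s hs1 (Fin.rev l)) (by clear * -; revert l; decide) hs
      exact absurd (hmax r δ' l' pos'' _ (hpq.trans hqr) C'') (not_le.2 hlt)
    · push Not at h
      exact absurd (hmax q δ l pos' _ hpq (C'.insert_mem hkd fun z hz ⟨s, hs⟩ => h z hz s hs))
        (not_le.2 hlt)
  -- A preliminary step puts each freed point in a fresh orbit of the wide factor, with only one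
  -- matched class.
  obtain ⟨h, hh⟩ := H.proper i
  obtain ⟨p₁, v, hp, C₁, hv, hf, -⟩ := C.step H hij hh
  have hdom₁ : ∀ (q : State φ X) (δ : Amalgam φ) (l : Fin 2) (pos' : ι → X l), p₁ ≤ q →
      IsConfig x q δ l pos' Z → ∀ k ∉ Z, (⟨l, pos' k⟩ : Pt X) ∈ q.dom :=
    fun q δ l pos' hq => hdom q δ l pos' (hp.trans hq)
  obtain ⟨e, he, hce⟩ := p₁.exists_reach_notMem_dom H hw (hdom p₁ _ _ _ hp C₁ c hcZ)
  -- The walk must end at a place that stays unmatched while the freed points move on: neither in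
  -- the class of a freed point nor in an orbit that is fresh for `p₁`.
  obtain ⟨e', he', hreach, hnz, hnf⟩ : ∃ e' ∉ p₁.dom,
      Relation.ReflTransGen p₁.Succ ⟨i, h • v c⟩ e' ∧
      (∀ z ∈ Z, ¬ ∃ s, e' = tw φ s ⟨i, h • v z⟩) ∧ ¬ p₁.Fresh e' := by
    obtain ⟨d, hcd, hde⟩ := Relation.TransGen.tail'_iff.1 hce
    obtain ⟨m, g, w, hg, hr, rfl⟩ := hde
    by_cases hz : ∃ z ∈ Z, ∃ s, (⟨m, g • w⟩ : Pt X) = tw φ s ⟨i, h • v z⟩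
    · obtain ⟨z, hz, s, hs⟩ := hz
      obtain rfl : m = i := congrArg Sigma.fst hs
      -- The exit found is occupied by `z`. Its orbit has a third class, that of `g' • v z`,
      -- distinct from the class of entry and from that of `h • v z`.
      obtain ⟨g', hg', hgh'⟩ := hi h
      have ho : SameOrb (G := G) (⟨m, w⟩ : Pt X) ⟨m, v z⟩ := by
        have h1 := SameOrb.mk m g w
        rw [hs] at h1
        exact (h1.trans (SameOrb.tw φ s _).symm).trans (SameOrb.mk m h _).symm
      have hfz := (hf z (C.out z hz)).2
      obtain ⟨t, ht⟩ := hfz _ (State.right_mem_dom hr) ho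
      have hgv : (g' * (φ m t)⁻¹) • w = g' • v z := by
        simp only [tw_mk, Sigma.mk.injEq, heq_eq_eq, true_and] at ht
        rw [ht, ← mul_smul, inv_mul_cancel_right]
      have hout : (⟨m, g' • v z⟩ : Pt X) ∉ p₁.dom := fun hd => by
        obtain ⟨r, hr⟩ := hfz _ hd (SameOrb.mk m g' _).symm
        exact H.smul_ne_tw hg' _ r hr
      have hsucc : p₁.Succ d ⟨m, g' • v z⟩ := by
        refine ⟨m, g' * (φ m t)⁻¹, w, fun h' => hg' ?_, hr, by rw [hgv]⟩
        exact ((φ m).range.mul_mem_cancel_right ((φ m).range.inv_mem ⟨t, rfl⟩)).1 h'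
      refine ⟨⟨m, g' • v z⟩, hout, hcd.tail hsucc, ?_, fun hfr => ?_⟩
      · rintro z' hz' ⟨r, hr'⟩
        have ho' : SameOrb (G := G) (⟨m, v z'⟩ : Pt X) ⟨m, v z⟩ := by
          have h1 := SameOrb.mk m g' (v z)
          rw [hr'] at h1
          exact (SameOrb.mk m h _).trans ((SameOrb.tw φ r _).trans h1.symm)
        obtain ⟨u, hu⟩ := hfz _ (State.right_mem_dom (hv z')) ho'
        have hzz : z' = z := C.indep z' hz' z hz
          ⟨u, p₁.uniq (p₁.symm (hv z')) (hu ▸ p₁.symm (p₁.twist u (hv z)))⟩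
        subst hzz
        simp only [tw_mk, Sigma.mk.injEq, heq_eq_eq, true_and, ← mul_smul] at hr'
        exact hgh' ⟨r, by rw [H.smul_inj hr', mul_inv_cancel_right]⟩
      · exact hfr _ (State.right_mem_dom (hv z)) (SameOrb.mk m g' _)
    · push Not at hz
      exact ⟨_, he, hce.to_reflTransGen, fun z h1 ⟨s, hs⟩ => hz z h1 s hs, fun hfr =>
        hfr _ (State.right_mem_dom hr) (SameOrb.mk m g w)⟩
  obtain ⟨q, δ, l, pos', hpq, C₂, hc, -, hq⟩ := C₁.follow H hdom₁ c hreach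
  have hcd := hdom₁ q δ l pos' hpq C₂ c hcZ
  rw [hc] at hcd
  rcases hq _ hcd with h1 | ⟨z, hz, h1⟩ | h1
  exacts [he' h1, hnz z hz h1, hnf h1]

/-- If the factor to be entered is not wide, one more step makes the other factor, which is wide,
the next one. -/
theorem IsConfig.improve [∀ j, Countable (X j)] (H : FreePair φ X)
    (hw : ∀ i j : Fin 2, i ≠ j → Wide φ i ∨ Wide φ j)
    (hsep : ∀ s : S, s ≠ 1 → ∀ i, Sep φ i s) {x : ι → X 0} (hx : Function.Injective x)
    {Z : Finset ι} (hZ : Z ≠ Finset.univ) {p : State φ X} {j : Fin 2} {γ : Amalgam φ}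
    {pos : ι → X j} (C : IsConfig x p γ j pos Z) :
    ∃ (q : State φ X) (δ : Amalgam φ) (l : Fin 2) (pos' : ι → X l) (Z' : Finset ι), p ≤ q ∧
      IsConfig x q δ l pos' Z' ∧ Z.card < Z'.card := by
  have hj : Fin.rev j ≠ j := by clear * -; revert j; decide
  by_cases hi : Wide φ (Fin.rev j)
  · exact C.improve_of_wide H hw hsep hx hZ hj hi
  · obtain ⟨h, hh⟩ := H.proper (Fin.rev j)
    obtain ⟨q, v, hpq, C', -⟩ := C.step H hj hh
    obtain ⟨r, δ, l, pos', Z', hqr, C''⟩ :=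
      C'.improve_of_wide H hw hsep hx hZ hj.symm ((hw _ _ hj).resolve_left hi)
    exact ⟨r, δ, l, pos', Z', hpq.trans hqr, C''⟩

/-- Finitely many points can be moved simultaneously to distinct classes out of the domain. -/
theorem exists_displacement [∀ j, Countable (X j)] (H : FreePair φ X)
    (hw : ∀ i j : Fin 2, i ≠ j → Wide φ i ∨ Wide φ j)
    (hsep : ∀ s : S, s ≠ 1 → ∀ i, Sep φ i s) {x : ι → X 0} (hx : Function.Injective x)
    (p : State φ X) : ∃ (q : State φ X) (γ : Amalgam φ) (j : Fin 2) (pos : ι → X j), p ≤ q ∧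
      IsConfig x q γ j pos Finset.univ := by
  suffices h : ∀ n ≤ Fintype.card ι, ∃ (q : State φ X) (γ : Amalgam φ) (j : Fin 2)
      (pos : ι → X j) (Z : Finset ι), p ≤ q ∧ IsConfig x q γ j pos Z ∧ n ≤ Z.card by
    obtain ⟨q, γ, j, pos, Z, hq, C, hZ⟩ := h _ le_rfl
    obtain rfl : Z = Finset.univ := Finset.eq_univ_of_card _ (le_antisymm (Finset.card_le_univ _) hZ)
    exact ⟨q, γ, j, pos, hq, C⟩
  intro n
  induction n with
  | zero => exact fun _ => ⟨p, 1, 0, x, ∅, le_rfl,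
      ⟨fun k => Forces.one p _, by simp, by simp⟩, Nat.zero_le _⟩
  | succ n ih =>
    intro hn
    obtain ⟨q, γ, j, pos, Z, hq, C, hZ⟩ := ih (by omega)
    by_cases hZu : Z = Finset.univ
    · subst hZu
      exact ⟨q, γ, j, pos, _, hq, C, by rwa [Finset.card_univ]⟩
    · obtain ⟨r, δ, l, pos', Z', hqr, C', hlt⟩ := C.improve H hw hsep hx hZu
      exact ⟨r, δ, l, pos', Z', hq.trans hqr, C', by omega⟩

end Displacement

/-! ### Density of high transitivity. -/

section Density

open Monoid (PushoutI)

variable {G : Fin 2 → Type*} {S : Type*} [∀ j, Group (G j)] [Group S] {φ : ∀ j, S →* G j}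
variable {X : Fin 2 → Type*} [∀ j, MulAction (G j) (X j)]

/-- Attach `a` to `w` and `b` to `g • w`, for a fresh `w`; then `g` sends `a` to `b`. A third class
of the orbit of `w`, which exists as the factor is wide, remains as an exit. -/
theorem State.exists_connect (H : FreePair φ X) (p : State φ X) {i j : Fin 2} (hij : i ≠ j)
    (hi : Wide φ i) {g : G i} (hg : g ∉ (φ i).range) {a b : X j}
    (ha : (⟨j, a⟩ : Pt X) ∉ p.dom) (hb : (⟨j, b⟩ : Pt X) ∉ p.dom)
    (hab : ¬ ∃ s, (⟨j, b⟩ : Pt X) = tw φ s ⟨j, a⟩) :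
    ∃ q : State φ X, p ≤ q ∧ Forces q (PushoutI.of i g) ⟨j, a⟩ ⟨j, b⟩ ∧
      ∀ y ∈ q.dom, y ∈ p.dom ∨ (∃ s, y = tw φ s ⟨j, a⟩) ∨ (∃ s, y = tw φ s ⟨j, b⟩) ∨
        y.1 = i := by
  obtain ⟨w, hw, -⟩ := p.exists_fresh H i Set.finite_empty
  obtain ⟨p₁, hp, hr, hre⟩ := p.exists_attach H ha hw hij.symm
  have hdom₁ : ∀ y ∈ p₁.dom, y ∈ p.dom ∨ (∃ s, y = tw φ s ⟨j, a⟩) ∨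
      ∃ s, y = tw φ s ⟨i, w⟩ := by
    rintro y ⟨z, hz⟩
    rw [hre] at hz
    exact edgeRel_dom hz
  have hb₁ : (⟨j, b⟩ : Pt X) ∉ p₁.dom := fun h => by
    rcases hdom₁ _ h with h | h | ⟨s, h⟩
    exacts [hb h, hab h, hij (congrArg Sigma.fst h).symm]
  have hgw : SameOrb (G := G) (⟨i, w⟩ : Pt X) ⟨i, g • w⟩ := SameOrb.mk i g w
  have hw₁ : (⟨i, g • w⟩ : Pt X) ∉ p₁.dom := fun h => by
    rcases hdom₁ _ h with h | ⟨s, h⟩ | ⟨s, h⟩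
    exacts [hw _ h hgw.symm, hij (congrArg Sigma.fst h), H.smul_ne_tw hg _ s h]
  obtain ⟨g', hg', hgg'⟩ := hi g
  have hgw' : SameOrb (G := G) (⟨i, g • w⟩ : Pt X) ⟨i, g' • w⟩ :=
    hgw.symm.trans (SameOrb.mk i g' w)
  have hout : ∀ d, ¬ p₁.edgeRel ⟨j, b⟩ ⟨i, g • w⟩ ⟨i, g' • w⟩ d := fun d hd => by
    rcases edgeRel_dom hd with h | ⟨s, h⟩ | ⟨s, h⟩
    · rcases hdom₁ _ h with h | ⟨s, h⟩ | ⟨s, h⟩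
      exacts [hw _ h (SameOrb.mk i g' w).symm, hij (congrArg Sigma.fst h),
        H.smul_ne_tw hg' _ s h]
    · exact hij (congrArg Sigma.fst h)
    · simp only [tw_mk, Sigma.mk.injEq, heq_eq_eq, true_and, ← mul_smul] at h
      exact hgg' ⟨s, by rw [H.smul_inj h, mul_inv_cancel_right]⟩
  refine ⟨p₁.addEdge H ⟨j, b⟩ ⟨i, g • w⟩ hb₁ hw₁ hij.symm fun c => ?_,
    hp.trans fun _ _ => Or.inl, ?_, ?_⟩
  · obtain ⟨e, he, hc⟩ := p₁.exit c
    have hc' := hc.mono (r' := p₁.edgeRel ⟨j, b⟩ ⟨i, g • w⟩) fun _ _ => Or.inl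
    by_cases heb : ∃ s, e = tw φ s ⟨j, b⟩
    · obtain ⟨s, rfl⟩ := heb
      exact ⟨_, hout, ((hc'.orb (SameOrb.tw φ s _).symm).rel (p₁.edgeRel_self _ _)).orb hgw'⟩
    by_cases hew : ∃ s, e = tw φ s ⟨i, g • w⟩
    · obtain ⟨s, rfl⟩ := hew
      exact ⟨_, hout, (hc'.orb (SameOrb.tw φ s _).symm).orb hgw'⟩
    refine ⟨e, fun d hd => ?_, hc'⟩
    rcases edgeRel_dom hd with ⟨b, h1⟩ | h1 | h1
    exacts [he b h1, heb h1, hew h1]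
  · set q := p₁.addEdge H ⟨j, b⟩ ⟨i, g • w⟩ hb₁ hw₁ hij.symm _
    have h1 : Forces q 1 ⟨i, g • w⟩ ⟨j, b⟩ := Forces.rel (q.symm (p₁.edgeRel_self _ _))
    have h2 : q.rel ⟨j, a⟩ ⟨i, w⟩ := Or.inl hr
    simpa using h1.mul ((Forces.one q _).rel_smul h2 g)
  · rintro y ⟨z, hz⟩
    rcases edgeRel_dom hz with h | h | ⟨s, rfl⟩
    · rcases hdom₁ y h with h | h | ⟨s, rfl⟩
      exacts [Or.inl h, Or.inr (Or.inl h), Or.inr (Or.inr (Or.inr rfl))]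
    · exact Or.inr (Or.inr (Or.inl h))
    · exact Or.inr (Or.inr (Or.inr rfl))

/-- The same `g` serves all the pairs, each with its own fresh orbit. The bound on the domain keeps
the remaining endpoints unmatched during the induction. -/
theorem State.exists_connect_finset (H : FreePair φ X) (p : State φ X) {i j : Fin 2}
    (hij : i ≠ j) (hi : Wide φ i) {g : G i} (hg : g ∉ (φ i).range) {κ : Type*}
    {c : κ ⊕ κ → X j} (hc : ∀ k, (⟨j, c k⟩ : Pt X) ∉ p.dom)
    (hcc : ∀ k l, (∃ s, (⟨j, c k⟩ : Pt X) = tw φ s ⟨j, c l⟩) → k = l) (T : Finset κ) :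
    ∃ q : State φ X, p ≤ q ∧
      (∀ k ∈ T, Forces q (PushoutI.of i g) ⟨j, c (Sum.inl k)⟩ ⟨j, c (Sum.inr k)⟩) ∧
      ∀ y ∈ q.dom, y ∈ p.dom ∨ (∃ k ∈ T, ∃ s, y = tw φ s ⟨j, c (Sum.inl k)⟩) ∨
        (∃ k ∈ T, ∃ s, y = tw φ s ⟨j, c (Sum.inr k)⟩) ∨ y.1 = i := by
  classical
  induction T using Finset.induction_on with
  | empty => exact ⟨p, le_rfl, by simp, fun y hy => Or.inl hy⟩
  | insert k T hk ih =>
    obtain ⟨q, hpq, hf, hd⟩ := ih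
    have ha : (⟨j, c (Sum.inl k)⟩ : Pt X) ∉ q.dom := fun h => by
      rcases hd _ h with h | ⟨l, hl, h⟩ | ⟨l, hl, h⟩ | h
      · exact hc _ h
      · exact hk (Sum.inl_injective (hcc _ _ h) ▸ hl)
      · exact absurd (hcc _ _ h) Sum.inl_ne_inr
      · exact hij h.symm
    have hb : (⟨j, c (Sum.inr k)⟩ : Pt X) ∉ q.dom := fun h => by
      rcases hd _ h with h | ⟨l, hl, h⟩ | ⟨l, hl, h⟩ | h
      · exact hc _ h
      · exact absurd (hcc _ _ h) Sum.inr_ne_inl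
      · exact hk (Sum.inr_injective (hcc _ _ h) ▸ hl)
      · exact hij h.symm
    obtain ⟨r, hqr, hfr, hdr⟩ := q.exists_connect H hij hi hg ha hb fun h =>
      absurd (hcc _ _ h) Sum.inr_ne_inl
    refine ⟨r, hpq.trans hqr, fun l hl => ?_, fun y hy => ?_⟩
    · rcases Finset.mem_insert.1 hl with rfl | hl
      exacts [hfr, (hf l hl).mono hqr]
    · rcases hdr y hy with h | h | h | h
      · rcases hd y h with h | ⟨l, hl, h⟩ | ⟨l, hl, h⟩ | h
        · exact Or.inl h
        · exact Or.inr (Or.inl ⟨l, Finset.mem_insert_of_mem hl, h⟩)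
        · exact Or.inr (Or.inr (Or.inl ⟨l, Finset.mem_insert_of_mem hl, h⟩))
        · exact Or.inr (Or.inr (Or.inr h))
      · exact Or.inr (Or.inl ⟨k, Finset.mem_insert_self _ _, h⟩)
      · exact Or.inr (Or.inr (Or.inl ⟨k, Finset.mem_insert_self _ _, h⟩))
      · exact Or.inr (Or.inr (Or.inr h))

/-- States that send a tuple to another one, disjoint from it, are dense. -/
theorem exists_forces_of_disjoint [∀ j, Countable (X j)] (H : FreePair φ X)
    (hw : ∀ i j : Fin 2, i ≠ j → Wide φ i ∨ Wide φ j)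
    (hsep : ∀ s : S, s ≠ 1 → ∀ i, Sep φ i s) {κ : Type*} [Fintype κ] {x : κ ⊕ κ → X 0}
    (hx : Function.Injective x) (p : State φ X) :
    ∃ (q : State φ X) (γ : Amalgam φ), p ≤ q ∧
      ∀ k, Forces q γ ⟨0, x (Sum.inl k)⟩ ⟨0, x (Sum.inr k)⟩ := by
  have key : ∀ {q : State φ X} {γ : Amalgam φ} {j : Fin 2} {pos : κ ⊕ κ → X j} {i : Fin 2},
      p ≤ q → IsConfig x q γ j pos Finset.univ → i ≠ j → Wide φ i →
      ∃ (q : State φ X) (γ : Amalgam φ), p ≤ q ∧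
        ∀ k, Forces q γ ⟨0, x (Sum.inl k)⟩ ⟨0, x (Sum.inr k)⟩ := by
    intro q γ j pos i hpq C hij hi
    obtain ⟨g, hg⟩ := H.proper i
    obtain ⟨r, hqr, hr, -⟩ := q.exists_connect_finset H hij hi hg
      (fun k => C.out k (Finset.mem_univ k))
      (fun k l => C.indep k (Finset.mem_univ k) l (Finset.mem_univ l)) Finset.univ
    exact ⟨r, γ⁻¹ * (PushoutI.of i g * γ), hpq.trans hqr, fun k =>
      ((C.forces (Sum.inr k)).mono hqr).inv.mul
        ((hr k (Finset.mem_univ k)).mul ((C.forces (Sum.inl k)).mono hqr))⟩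
  obtain ⟨q, γ, j, pos, hpq, C⟩ := exists_displacement H hw hsep hx p
  have hj : Fin.rev j ≠ j := by clear * -; revert j; decide
  by_cases hi : Wide φ (Fin.rev j)
  · exact key hpq C hj hi
  · obtain ⟨h, hh⟩ := H.proper (Fin.rev j)
    obtain ⟨r, v, hqr, C', -⟩ := C.step H hj hh
    exact key (hpq.trans hqr) C' hj.symm ((hw _ _ hj).resolve_left hi)

theorem FreePair.infinite (H : FreePair φ X) (j : Fin 2) : Infinite (X j) := by
  have := H.orbits j
  exact Infinite.of_surjective
    (Quotient.mk _ : X j → MulAction.orbitRel.Quotient (G j) (X j)) Quotient.mk_surjective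

/-- States that send a tuple to another one are dense. -/
theorem exists_forces_tuple [∀ j, Countable (X j)] (H : FreePair φ X)
    (hw : ∀ i j : Fin 2, i ≠ j → Wide φ i ∨ Wide φ j)
    (hsep : ∀ s : S, s ≠ 1 → ∀ i, Sep φ i s) {κ : Type*} [Fintype κ] {x y : κ → X 0}
    (hx : Function.Injective x) (hy : Function.Injective y) (p : State φ X) :
    ∃ (q : State φ X) (γ : Amalgam φ), p ≤ q ∧ ∀ k, Forces q γ ⟨0, x k⟩ ⟨0, y k⟩ := by
  classical
  have := H.infinite 0
  have hfin : (Set.range x ∪ Set.range y).Finite :=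
    (Set.finite_range x).union (Set.finite_range y)
  have hinf := hfin.infinite_compl
  have := hinf.to_subtype
  -- The tuples `x` and `y` may overlap; a third tuple, disjoint from both, serves as a relay.
  let z : κ ↪ ((Set.range x ∪ Set.range y)ᶜ : Set (X 0)) :=
    (Fintype.equivFin κ).toEmbedding.trans (Fin.valEmbedding.trans (Infinite.natEmbedding _))
  have hz : Function.Injective fun k => (z k : X 0) := Subtype.val_injective.comp z.injective
  have hz' : ∀ k, (z k : X 0) ∉ Set.range x ∪ Set.range y := fun k => (z k).2
  obtain ⟨q, γ, hpq, hq⟩ := exists_forces_of_disjoint H hw hsep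
    (x := Sum.elim x fun k => (z k : X 0))
    (hx.sumElim hz fun a b h => hz' b (Or.inl ⟨a, h⟩)) p
  obtain ⟨r, δ, hqr, hr⟩ := exists_forces_of_disjoint H hw hsep
    (x := Sum.elim (fun k => (z k : X 0)) y)
    (hz.sumElim hy fun a b h => hz' a (Or.inr ⟨b, h.symm⟩)) q
  exact ⟨r, δ * γ, hpq.trans hqr, fun k => (hr k).mul ((hq k).mono hqr)⟩

/-! ### Density of high faithfulness: labels in the amalgam. -/

/-- A labelling, by elements of the amalgam, of a set of points that is closed under the moves
of a state. -/
structure IsLabelling (p : State φ X) (C : Set (Pt X)) (ℓ : Pt X → Amalgam φ) (c : Pt X) :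
    Prop where
  smul : ∀ {j : Fin 2} {x : X j} (g : G j), (⟨j, x⟩ : Pt X) ∈ C →
    (⟨j, g • x⟩ : Pt X) ∈ C ∧ ℓ ⟨j, g • x⟩ = PushoutI.of j g * ℓ ⟨j, x⟩
  rel : ∀ {a b}, p.rel a b → a ∈ C → b ∈ C ∧ ℓ b = ℓ a
  near : ∀ a ∈ C, SameOrb (G := G) c a ∨ ∃ y ∈ p.dom, SameOrb (G := G) y a

/-- The field `near` lets the new orbit be chosen disjoint from `C`, so labels on it can be
prescribed freely; by freeness of the action, `g • v` determines `g`. -/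
theorem IsLabelling.extend (H : FreePair φ X) {p : State φ X} {C : Set (Pt X)}
    {ℓ : Pt X → Amalgam φ} {c : Pt X} (hL : IsLabelling p C ℓ c) {a : Pt X} (ha : a ∈ C)
    (had : a ∉ p.dom) {i : Fin 2} (hi : a.1 ≠ i) :
    ∃ (q : State φ X) (C' : Set (Pt X)) (ℓ' : Pt X → Amalgam φ) (v : X i), p ≤ q ∧ C ⊆ C' ∧
      (∀ b ∈ C, ℓ' b = ℓ b) ∧ IsLabelling q C' ℓ' c ∧ q.rel a ⟨i, v⟩ := by
  classical
  obtain ⟨v, hv, hvc⟩ := p.exists_fresh H i (Set.finite_singleton c)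
  obtain ⟨q, hpq, hq, hqe⟩ := p.exists_attach H had hv hi
  let O : Set (Pt X) := {b | SameOrb (G := G) ⟨i, v⟩ b}
  have hO : ∀ b ∈ C, b ∉ O := fun b hb hbO => by
    rcases hL.near b hb with h | ⟨y, hy, h⟩
    · exact hvc c rfl (h.trans hbO.symm)
    · exact hv y hy (h.trans hbO.symm)
  have hOmk : ∀ g : G i, (⟨i, g • v⟩ : Pt X) ∈ O := fun g => SameOrb.mk i g v
  let ℓ' : Pt X → Amalgam φ := fun b =>
    if h : ∃ g : G i, b = ⟨i, g • v⟩ then PushoutI.of i h.choose * ℓ a else ℓ b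
  have hℓC : ∀ b ∈ C, ℓ' b = ℓ b := fun b hb => dif_neg fun ⟨g, h⟩ => hO b hb (h ▸ hOmk g)
  have hℓO : ∀ g : G i, ℓ' ⟨i, g • v⟩ = PushoutI.of i g * ℓ a := fun g => by
    have h : ∃ g' : G i, (⟨i, g • v⟩ : Pt X) = ⟨i, g' • v⟩ := ⟨g, rfl⟩
    have h' : g • v = h.choose • v := by simpa using h.choose_spec
    simp only [ℓ']
    rw [dif_pos h, ← H.smul_inj h']
  have htw : ∀ b ∈ C, ∀ s, tw φ s b ∈ C ∧ ℓ (tw φ s b) = PushoutI.base φ s * ℓ b :=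
    fun b hb s => by
      rw [← PushoutI.of_apply_eq_base φ b.1 s]
      exact hL.smul (φ b.1 s) hb
  refine ⟨q, C ∪ O, ℓ', v, hpq, Set.subset_union_left, hℓC, ⟨?_, ?_, ?_⟩, hq⟩
  · rintro j x g (h | h)
    · have h' := hL.smul g h
      exact ⟨Or.inl h'.1, by rw [hℓC _ h'.1, hℓC _ h, h'.2]⟩
    · obtain rfl : i = j := h.fst
      obtain ⟨g', rfl⟩ := sameOrb_mk_iff.1 h
      rw [← mul_smul]
      exact ⟨Or.inr (hOmk _), by rw [hℓO, hℓO, map_mul, mul_assoc]⟩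
  · intro b d hbd hb
    rw [hqe] at hbd
    rcases hbd with h | ⟨s, ⟨rfl, rfl⟩ | ⟨rfl, rfl⟩⟩
    · rcases hb with hb | hb
      · have h' := hL.rel h hb
        exact ⟨Or.inl h'.1, by rw [hℓC _ h'.1, hℓC _ hb, h'.2]⟩
      · exact absurd hb.symm (hv b ⟨d, h⟩)
    · have h1 := htw a ha s
      exact ⟨Or.inr (hOmk _), by
        rw [hℓC _ h1.1, h1.2, tw_mk, hℓO, PushoutI.of_apply_eq_base]⟩
    · have h1 := htw a ha s
      exact ⟨Or.inl h1.1, by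
        rw [hℓC _ h1.1, h1.2, tw_mk, hℓO, PushoutI.of_apply_eq_base]⟩
  · rintro b (hb | hb)
    · rcases hL.near b hb with h | ⟨y, hy, h⟩
      · exact Or.inl h
      · exact Or.inr ⟨y, State.dom_mono hpq hy, h⟩
    · exact Or.inr ⟨_, State.right_mem_dom hq, hb⟩

theorem IsLabelling.trace_of (H : FreePair φ X) {p : State φ X} {C : Set (Pt X)}
    {ℓ : Pt X → Amalgam φ} {c : Pt X} (hL : IsLabelling p C ℓ c) {a : Pt X} (ha : a ∈ C)
    (i : Fin 2) (g : G i) :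
    ∃ (q : State φ X) (C' : Set (Pt X)) (ℓ' : Pt X → Amalgam φ) (b : X i), p ≤ q ∧ C ⊆ C' ∧
      (∀ b ∈ C, ℓ' b = ℓ b) ∧ IsLabelling q C' ℓ' c ∧ Forces q (PushoutI.of i g) a ⟨i, b⟩ ∧
      (⟨i, b⟩ : Pt X) ∈ C' ∧ ℓ' ⟨i, b⟩ = PushoutI.of i g * ℓ a := by
  obtain ⟨j, x⟩ := a
  by_cases hij : j = i
  · subst hij
    have h := hL.smul g ha
    exact ⟨p, C, ℓ, g • x, le_rfl, subset_rfl, fun _ _ => rfl, hL, Forces.smul p g x, h.1, h.2⟩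
  obtain ⟨q, C', ℓ', v, hpq, hC, hℓ, hL', hv⟩ : ∃ (q : State φ X) (C' : Set (Pt X))
      (ℓ' : Pt X → Amalgam φ) (v : X i), p ≤ q ∧ C ⊆ C' ∧ (∀ b ∈ C, ℓ' b = ℓ b) ∧
      IsLabelling q C' ℓ' c ∧ q.rel ⟨j, x⟩ ⟨i, v⟩ := by
    by_cases had : (⟨j, x⟩ : Pt X) ∈ p.dom
    · obtain ⟨v, hv⟩ := State.exists_rel (Ne.symm hij) had
      exact ⟨p, C, ℓ, v, le_rfl, subset_rfl, fun _ _ => rfl, hL, hv⟩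
    · exact hL.extend H ha had hij
  have h1 := hL'.rel hv (hC ha)
  have h2 := hL'.smul g h1.1
  refine ⟨q, C', ℓ', g • v, hpq, hC, hℓ, hL', ?_, h2.1, by rw [h2.2, h1.2, hℓ _ ha]⟩
  simpa using (Forces.one q _).rel_smul hv g

/-- The orbits needed to define the action of `γ` at `a` are attached letter by letter, and the
labels record the product of the letters. -/
theorem IsLabelling.trace (H : FreePair φ X) (γ : Amalgam φ) : ∀ {p : State φ X}
    {C : Set (Pt X)} {ℓ : Pt X → Amalgam φ} {c : Pt X}, IsLabelling p C ℓ c → ∀ {a : Pt X},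
    a ∈ C → ∃ (q : State φ X) (C' : Set (Pt X)) (ℓ' : Pt X → Amalgam φ) (b : Pt X), p ≤ q ∧
      C ⊆ C' ∧ (∀ b ∈ C, ℓ' b = ℓ b) ∧ IsLabelling q C' ℓ' c ∧ Forces q γ a b ∧ b ∈ C' ∧
      ℓ' b = γ * ℓ a := by
  induction γ using PushoutI.induction_on with
  | of i g =>
    intro p C ℓ c hL a ha
    obtain ⟨q, C', ℓ', b, h⟩ := hL.trace_of H ha i g
    exact ⟨q, C', ℓ', _, h⟩
  | base s =>
    intro p C ℓ c hL a ha
    have h : tw φ s a ∈ C ∧ ℓ (tw φ s a) = PushoutI.base φ s * ℓ a := by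
      rw [← PushoutI.of_apply_eq_base φ a.1 s]
      exact hL.smul (φ a.1 s) ha
    exact ⟨p, C, ℓ, tw φ s a, le_rfl, subset_rfl, fun _ _ => rfl, hL, Forces.tw p s a, h⟩
  | mul γ δ ih ih' =>
    intro p C ℓ c hL a ha
    obtain ⟨q, C', ℓ', b, hpq, hC, hℓ, hL', hf, hb, hb'⟩ := ih' hL ha
    obtain ⟨r, C'', ℓ'', d, hqr, hC', hℓ', hL'', hf', hd, hd'⟩ := ih hL' hb
    exact ⟨r, C'', ℓ'', d, hpq.trans hqr, hC.trans hC',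
      fun e he => by rw [hℓ' _ (hC he), hℓ _ he], hL'', hf'.mul (hf.mono hqr), hd,
      by rw [hd', hb', mul_assoc]⟩

/-- States that force finitely many non-trivial elements to move some point out of a given finite
set are dense. -/
theorem exists_forces_moved [∀ j, Countable (X j)] (H : FreePair φ X) (F : Finset (Amalgam φ))
    (hF : 1 ∉ F) (A : Finset (X 0)) (p : State φ X) :
    ∃ q : State φ X, p ≤ q ∧ ∃ x ∉ A, ∀ γ ∈ F, ∃ y ≠ x, Forces q γ ⟨0, x⟩ ⟨0, y⟩ := by
  classical
  obtain ⟨x, hx, hxA⟩ := p.exists_fresh H 0 ((A.finite_toSet).image (Sigma.mk (β := X) 0))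
  have hxA' : x ∉ A := fun h => hxA _ ⟨x, h, rfl⟩ (SameOrb.refl _)
  let ℓ₀ : Pt X → Amalgam φ := fun b =>
    if h : ∃ g : G 0, b = ⟨0, g • x⟩ then PushoutI.of 0 h.choose else 1
  have hℓ₀ : ∀ g : G 0, ℓ₀ ⟨0, g • x⟩ = PushoutI.of 0 g := fun g => by
    have h : ∃ g' : G 0, (⟨0, g • x⟩ : Pt X) = ⟨0, g' • x⟩ := ⟨g, rfl⟩
    have h' : g • x = h.choose • x := by simpa using h.choose_spec
    simp only [ℓ₀]
    rw [dif_pos h, ← H.smul_inj h']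
  have hL₀ : IsLabelling p {b | SameOrb (G := G) ⟨0, x⟩ b} ℓ₀ ⟨0, x⟩ := by
    refine ⟨?_, fun {a b} hab ha => absurd (SameOrb.symm ha) (hx a ⟨b, hab⟩),
      fun a ha => Or.inl ha⟩
    intro j y g hy
    obtain rfl : 0 = j := SameOrb.fst hy
    obtain ⟨g', rfl⟩ := sameOrb_mk_iff.1 hy
    refine ⟨hy.trans (SameOrb.mk 0 g _), ?_⟩
    rw [← mul_smul, hℓ₀, hℓ₀, map_mul]
  have hx₁ : ℓ₀ ⟨0, x⟩ = 1 := by simpa using hℓ₀ 1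
  -- The induction over `F` has to carry the labelling, so that one point `x`, of label 1, serves
  -- all the elements.
  suffices h : ∃ (q : State φ X) (C : Set (Pt X)) (ℓ : Pt X → Amalgam φ), p ≤ q ∧
      IsLabelling q C ℓ ⟨0, x⟩ ∧ (⟨0, x⟩ : Pt X) ∈ C ∧ ℓ ⟨0, x⟩ = 1 ∧
      ∀ γ ∈ F, ∃ y ≠ x, Forces q γ ⟨0, x⟩ ⟨0, y⟩ by
    obtain ⟨q, C, ℓ, hpq, -, -, -, h⟩ := h
    exact ⟨q, hpq, x, hxA', h⟩
  induction F using Finset.induction_on with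
  | empty => exact ⟨p, _, ℓ₀, le_rfl, hL₀, SameOrb.refl _, hx₁, by simp⟩
  | insert γ F _ ih =>
    rw [Finset.mem_insert, not_or] at hF
    obtain ⟨q, C, ℓ, hpq, hL, hxC, hxℓ, hq⟩ := ih hF.2
    obtain ⟨r, C', ℓ', b, hqr, hC, hℓ, hL', hf, hb, hb'⟩ := hL.trace H γ hxC
    -- The end `b` may lie in the second space; acting by the trivial element of `G 0` replaces it
    -- by a point of `X 0` with the same label.
    obtain ⟨t, C'', ℓ'', y, hrt, hC', hℓ', hL'', hf', hy, hy'⟩ := hL'.trace_of H hb 0 1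
    rw [map_one, one_mul, hb', hxℓ, mul_one] at hy'
    have hxt : ℓ'' ⟨0, x⟩ = 1 := by rw [hℓ' _ (hC hxC), hℓ _ hxC, hxℓ]
    refine ⟨t, C'', ℓ'', hpq.trans (hqr.trans hrt), hL'', hC' (hC hxC), hxt, fun δ hδ => ?_⟩
    rcases Finset.mem_insert.1 hδ with rfl | hδ
    · refine ⟨y, ?_, ?_⟩
      · rintro rfl
        exact hF.1 (hxt.symm.trans hy')
      · simpa using hf'.mul (hf.mono hrt)
    · obtain ⟨z, hz, hzf⟩ := hq δ hδ
      exact ⟨z, hz, hzf.mono (hqr.trans hrt)⟩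

end Density

/-! ### The topology of pointwise convergence and genericity. -/

section Genericity

open Monoid (PushoutI)

variable {G : Fin 2 → Type*} {S : Type*} [∀ j, Group (G j)] [Group S] {φ : ∀ j, S →* G j}
variable {X : Fin 2 → Type*} [∀ j, MulAction (G j) (X j)]

theorem PA.isOpen_apply_eq (x : X 0) (y : X 1) : IsOpen {τ : PA φ X | τ.1 x = y} := by
  let _ : TopologicalSpace (X 1) := ⊥
  have : DiscreteTopology (X 1) := ⟨rfl⟩
  have h : Continuous fun f : X 0 → X 1 => f x := continuous_apply x
  exact isOpen_induced_iff.2 ⟨_, (isOpen_discrete ({y} : Set (X 1))).preimage h, rfl⟩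

theorem PA.exists_finset_of_isOpen {U : Set (PA φ X)} (hU : IsOpen U) {τ : PA φ X}
    (hτ : τ ∈ U) : ∃ F : Finset (X 0), ∀ τ' : PA φ X, (∀ x ∈ F, τ'.1 x = τ.1 x) → τ' ∈ U := by
  let _ : TopologicalSpace (X 1) := ⊥
  obtain ⟨t, ht, rfl⟩ := isOpen_induced_iff.1 hU
  obtain ⟨F, u, hu, hut⟩ := isOpen_pi_iff.1 ht _ hτ
  refine ⟨F, fun τ' h => hut fun x hx => ?_⟩
  have := (hu x hx).2
  change τ.1 x ∈ u x at this
  change τ'.1 x ∈ u x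
  rwa [h x hx]

/-- Evaluating a word at a point uses only finitely many values of `τ` and `τ⁻¹`, and a value of
`τ⁻¹` is fixed by one value of `τ`. -/
theorem PA.exists_finset_action (τ : PA φ X) (γ : Amalgam φ) : ∀ x : X 0,
    ∃ F : Finset (X 0), ∀ τ' : PA φ X, (∀ y ∈ F, τ'.1 y = τ.1 y) →
      τ'.action γ x = τ.action γ x := by
  classical
  induction γ using PushoutI.induction_on with
  | of j g =>
    intro x
    match j, g with
    | 0, g => exact ⟨∅, fun τ' _ => by rw [action_of, action_of]; rfl⟩
    | 1, g =>
      refine ⟨{x, τ.1.symm (g • τ.1 x)}, fun τ' h => ?_⟩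
      rw [action_of, action_of, factorHom_one_apply, factorHom_one_apply, h x (by simp),
        Equiv.symm_apply_eq, h _ (by simp), Equiv.apply_symm_apply]
  | base s => exact fun x => ⟨∅, fun τ' _ => by rw [action_base, action_base]; rfl⟩
  | mul γ δ ih ih' =>
    intro x
    obtain ⟨F, hF⟩ := ih' x
    obtain ⟨F', hF'⟩ := ih (τ.action δ x)
    refine ⟨F ∪ F', fun τ' h => ?_⟩
    rw [map_mul, map_mul, Equiv.Perm.mul_apply, Equiv.Perm.mul_apply,
      hF τ' fun y hy => h y (Finset.mem_union_left _ hy),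
      hF' τ' fun y hy => h y (Finset.mem_union_right _ hy)]

theorem PA.isOpen_action (γ : Amalgam φ) (x : X 0) (P : X 0 → Prop) :
    IsOpen {τ : PA φ X | P (τ.action γ x)} := by
  rw [isOpen_iff_forall_mem_open]
  intro τ hτ
  obtain ⟨F, hF⟩ := τ.exists_finset_action γ x
  refine ⟨⋂ y ∈ F, {τ' | τ'.1 y = τ.1 y}, fun τ' h => ?_,
    isOpen_biInter_finset fun y _ => isOpen_apply_eq y _, by simp⟩
  simp only [Set.mem_iInter, Set.mem_ofPred_eq] at h ⊢
  rw [hF τ' h]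
  exact hτ

theorem HTA_subset_TA : HTA φ X ⊆ TA φ X := fun τ h x y => by
  obtain ⟨γ, hγ⟩ := h 1 (fun _ => x) (fun _ => y) (Function.injective_of_subsingleton _)
    (Function.injective_of_subsingleton _)
  exact ⟨γ, hγ 0⟩

theorem countable_amalgam [∀ j, Countable (G j)] : Countable (Amalgam φ) := by
  have h : Function.Surjective fun l : List (Σ j, G j) =>
      (l.map fun g => PushoutI.of (φ := φ) g.1 g.2).prod := by
    intro γ
    induction γ using PushoutI.induction_on with
    | of j g => exact ⟨[⟨j, g⟩], by simp⟩
    | base s => exact ⟨[⟨0, φ 0 s⟩], by simp [PushoutI.of_apply_eq_base]⟩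
    | mul γ δ h h' =>
      obtain ⟨l, rfl⟩ := h
      obtain ⟨l', rfl⟩ := h'
      exact ⟨l ++ l', by simp⟩
  exact h.countable

theorem isHighlyFaithful_iff {Γ Y : Type*} [Group Γ] (α : Γ →* Equiv.Perm Y) :
    IsHighlyFaithful α ↔ ∀ (F : {F : Finset Γ // 1 ∉ F}) (A : Finset Y),
      ∃ x ∉ A, ∀ γ ∈ F.1, α γ x ≠ x := by
  constructor
  · intro h F A
    obtain ⟨x, hx, hxA⟩ := (h F.1 F.2).exists_notMem_finset A
    exact ⟨x, hxA, hx⟩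
  · intro h F hF hfin
    obtain ⟨x, hx, hxF⟩ := h ⟨F, hF⟩ hfin.toFinset
    exact hx (hfin.mem_toFinset.2 hxF)

variable (X) in
/-- Pairs of tuples of distinct points. -/
abbrev TuplePair : Type _ :=
  Σ k : ℕ, {x : Fin k → X 0 // Function.Injective x} × {x : Fin k → X 0 // Function.Injective x}

theorem isGδ_HTA_inter_HFA [∀ j, Countable (X j)] [Countable (Amalgam φ)] :
    IsGδ (HTA φ X ∩ HFA φ X) := by
  have h1 : HTA φ X = ⋂ t : TuplePair X, ⋃ γ : Amalgam φ,
      ⋂ i, {τ : PA φ X | τ.action γ (t.2.1.1 i) = t.2.2.1 i} := by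
    ext τ
    simp only [Set.mem_iInter, Set.mem_iUnion]
    exact ⟨fun h t => h t.1 t.2.1.1 t.2.2.1 t.2.1.2 t.2.2.2,
      fun h k x y hx hy => h ⟨k, ⟨x, hx⟩, ⟨y, hy⟩⟩⟩
  have h2 : HFA φ X = ⋂ t : {F : Finset (Amalgam φ) // 1 ∉ F} × Finset (X 0),
      ⋃ x : {x : X 0 // x ∉ t.2}, ⋂ γ ∈ t.1.1, {τ : PA φ X | τ.action γ x ≠ x} := by
    ext τ
    simp only [Set.mem_iInter, Set.mem_iUnion, Subtype.exists, exists_prop]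
    exact (isHighlyFaithful_iff _).trans ⟨fun h t => h t.1 t.2, fun h F A => h (F, A)⟩
  rw [h1, h2]
  refine IsGδ.inter (IsGδ.iInter_of_isOpen fun t => ?_) (IsGδ.iInter_of_isOpen fun t => ?_)
  · exact isOpen_iUnion fun γ => isOpen_iInter_of_finite fun i => PA.isOpen_action γ _ (· = _)
  · exact isOpen_iUnion fun x => isOpen_biInter_finset fun γ _ =>
      PA.isOpen_action γ _ (· ≠ (x : X 0))

/-- Every state extends to a highly transitive and highly faithful action. -/
theorem exists_mem_HTA_inter_HFA [∀ j, Countable (X j)] [Countable (Amalgam φ)]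
    (H : FreePair φ X) (hw : ∀ i j : Fin 2, i ≠ j → Wide φ i ∨ Wide φ j)
    (hsep : ∀ s : S, s ≠ 1 → ∀ i, Sep φ i s) (p : State φ X) :
    ∃ τ ∈ HTA φ X ∩ HFA φ X, Extends τ p := by
  obtain ⟨τ, hτ, h⟩ := exists_generic H
    (ι := TuplePair X ⊕ ({F : Finset (Amalgam φ) // 1 ∉ F} × Finset (X 0)))
    (Sum.elim
      (fun t => {q | ∃ γ, ∀ i, Forces q γ ⟨0, t.2.1.1 i⟩ ⟨0, t.2.2.1 i⟩})
      (fun t => {q | ∃ x ∉ t.2, ∀ γ ∈ t.1.1, ∃ y ≠ x, Forces q γ ⟨0, x⟩ ⟨0, y⟩}))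
    (by
      rintro (t | t) p
      · obtain ⟨q, γ, hpq, h⟩ := exists_forces_tuple H hw hsep t.2.1.2 t.2.2.2 p
        exact ⟨q, ⟨γ, h⟩, hpq⟩
      · obtain ⟨q, hpq, h⟩ := exists_forces_moved H t.1.1 t.1.2 t.2 p
        exact ⟨q, h, hpq⟩) p
  refine ⟨τ, ⟨fun k x y hx hy => ?_, ?_⟩, hτ⟩
  · obtain ⟨q, ⟨γ, hγ⟩, hq⟩ := h (Sum.inl ⟨k, ⟨x, hx⟩, ⟨y, hy⟩⟩)
    exact ⟨γ, fun i => hγ i τ hq⟩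
  · refine (isHighlyFaithful_iff _).2 fun F A => ?_
    obtain ⟨q, ⟨x, hx, hq⟩, hτq⟩ := h (Sum.inr (F, A))
    refine ⟨x, hx, fun γ hγ => ?_⟩
    obtain ⟨y, hy, hf⟩ := hq γ hγ
    exact fun e => hy ((hf τ hτq).symm.trans e)

variable (φ X) in
/-- The empty matching. -/
def State.empty : State φ X where
  rel _ _ := False
  symm h := h
  uniq h := h.elim
  fiber h := h.elim
  twist _ h := h
  fin := ⟨∅, Set.finite_empty, fun _ _ h => h.elim⟩
  exit a := ⟨a, fun _ h => h, Conn.refl a⟩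

/-- The finite parts of a matching that defines a transitive action are states. -/
theorem exists_state_of_mem_TA (H : FreePair φ X) {τ : PA φ X} (hτ : τ ∈ TA φ X)
    (F : Finset (X 0)) : ∃ p : State φ X, ∀ x ∈ F, p.rel ⟨0, x⟩ ⟨1, τ.1 x⟩ := by
  let r : Pt X → Pt X → Prop := fun a b => ∃ s, ∃ x ∈ F,
    (a = tw φ s ⟨0, x⟩ ∧ b = tw φ s ⟨1, τ.1 x⟩) ∨ (a = tw φ s ⟨1, τ.1 x⟩ ∧ b = tw φ s ⟨0, x⟩)
  have hrs : ∀ {a b}, r a b → r b a := by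
    rintro a b ⟨s, x, hx, h | h⟩
    exacts [⟨s, x, hx, Or.inr h.symm⟩, ⟨s, x, hx, Or.inl h.symm⟩]
  have hrτ : ∀ {a b}, r a b → a.1 ≠ b.1 ∧ τ.proj a = τ.proj b := by
    have h : ∀ x, τ.proj ⟨0, x⟩ = τ.proj ⟨1, τ.1 x⟩ := fun x => (τ.1.symm_apply_apply x).symm
    rintro a b ⟨s, x, hx, ⟨rfl, rfl⟩ | ⟨rfl, rfl⟩⟩
    · exact ⟨Fin.zero_ne_one, by rw [PA.proj_tw, PA.proj_tw, h]⟩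
    · exact ⟨Fin.zero_ne_one.symm, by rw [PA.proj_tw, PA.proj_tw, h]⟩
  have hτi : ∀ {a b c : Pt X}, a.1 ≠ b.1 → a.1 ≠ c.1 → τ.proj a = τ.proj b →
      τ.proj a = τ.proj c → b = c := by
    rintro a ⟨j, y⟩ ⟨j', z⟩ h1 h2 h3 h4
    obtain rfl : j = j' := by
      have h1' : a.1 ≠ j := h1
      have h2' : a.1 ≠ j' := h2
      omega
    rw [τ.proj_injective j (h3.symm.trans h4)]
  refine ⟨⟨r, hrs, fun h h' => hτi (hrτ h).1 (hrτ h').1 (hrτ h).2 (hrτ h').2,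
    fun h => (hrτ h).1, ?_, ?_, ?_⟩, fun x hx => ⟨1, x, hx, Or.inl ⟨(tw_one φ _).symm,
      (tw_one φ _).symm⟩⟩⟩
  · rintro a b t ⟨s, x, hx, ⟨rfl, rfl⟩ | ⟨rfl, rfl⟩⟩
    · exact ⟨t * s, x, hx, Or.inl ⟨tw_tw φ _ _ _, tw_tw φ _ _ _⟩⟩
    · exact ⟨t * s, x, hx, Or.inr ⟨tw_tw φ _ _ _, tw_tw φ _ _ _⟩⟩
  · refine ⟨(Sigma.mk 0 '' (F : Set (X 0))) ∪ ((fun x => Sigma.mk 1 (τ.1 x)) '' (F : Set (X 0))),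
      (F.finite_toSet.image _).union (F.finite_toSet.image _), ?_⟩
    rintro a b ⟨s, x, hx, ⟨rfl, rfl⟩ | ⟨rfl, rfl⟩⟩
    · exact ⟨s, _, Or.inl ⟨x, hx, rfl⟩, rfl⟩
    · exact ⟨s, _, Or.inr ⟨x, hx, rfl⟩, rfl⟩
  -- A component without exit would be invariant under the action, so by transitivity it would
  -- contain all of `X 0`; but its points in `X 0` are matched, and hence lie in the finitely many
  -- orbits of the points of `F`.
  · intro c
    by_contra! hc
    have hdom : ∀ e, Conn (G := G) r c e → ∃ b, r e b := fun e he => by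
      by_contra! h
      exact hc e h he
    have h01 : ∀ x, Conn (G := G) r c ⟨0, x⟩ → Conn (G := G) r c ⟨1, τ.1 x⟩ := fun x hx => by
      obtain ⟨b, hb⟩ := hdom _ hx
      have : b = ⟨1, τ.1 x⟩ := hτi (hrτ hb).1 Fin.zero_ne_one (hrτ hb).2
        (τ.1.symm_apply_apply x).symm
      exact this ▸ hx.rel hb
    have h10 : ∀ y, Conn (G := G) r c ⟨1, y⟩ → Conn (G := G) r c ⟨0, τ.1.symm y⟩ := fun y hy => by
      obtain ⟨b, hb⟩ := hdom _ hy
      have : b = ⟨0, τ.1.symm y⟩ := hτi (hrτ hb).1 Fin.zero_ne_one.symm (hrτ hb).2 rfl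
      exact this ▸ hy.rel hb
    have hact : ∀ (γ : Amalgam φ) (x : X 0), Conn (G := G) r c ⟨0, x⟩ →
        Conn (G := G) r c ⟨0, τ.action γ x⟩ := by
      intro γ
      induction γ using PushoutI.induction_on with
      | of j g =>
        intro x hx
        rw [PA.action_of]
        match j, g with
        | 0, g => exact hx.orb (SameOrb.mk 0 g x)
        | 1, g => exact h10 _ ((h01 x hx).orb (SameOrb.mk 1 g (τ.1 x)))
      | base s =>
        intro x hx
        rw [PA.action_base]
        exact hx.orb (SameOrb.mk 0 (φ 0 s) x)
      | mul γ δ h h' =>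
        intro x hx
        rw [map_mul, Equiv.Perm.mul_apply]
        exact h _ (h' _ hx)
    obtain ⟨x, hx⟩ : ∃ x : X 0, Conn (G := G) r c ⟨0, x⟩ := by
      match c, h10 with
      | ⟨0, x⟩, _ => exact ⟨x, Conn.refl _⟩
      | ⟨1, y⟩, h10 => exact ⟨_, h10 y (Conn.refl _)⟩
    obtain ⟨y, hy⟩ := H.exists_notMem_orbits 0 (F.finite_toSet.image (Sigma.mk (β := X) 0))
    obtain ⟨γ, rfl⟩ := hτ x y
    obtain ⟨b, s, z, hz, ⟨h, -⟩ | ⟨h, -⟩⟩ := hdom _ (hact γ x hx)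
    · exact hy ⟨0, z⟩ ⟨z, hz, rfl⟩ (h ▸ SameOrb.tw φ s _)
    · exact Fin.zero_ne_one (congrArg Sigma.fst h)

/-- A neighbourhood of `τ` is controlled by its values on a finite set. These values form part of a
state, because `τ` is transitive, and the state has a generic extension. -/
theorem dense_HTA_inter_HFA [∀ j, Countable (X j)] [Countable (Amalgam φ)]
    (H : FreePair φ X) (hw : ∀ i j : Fin 2, i ≠ j → Wide φ i ∨ Wide φ j)
    (hsep : ∀ s : S, s ≠ 1 → ∀ i, Sep φ i s) :
    Dense {τ : TA φ X | (τ : PA φ X) ∈ HTA φ X ∩ HFA φ X} := by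
  intro τ
  rw [mem_closure_iff]
  intro O hO hτO
  obtain ⟨U, hU, rfl⟩ := isOpen_induced_iff.1 hO
  obtain ⟨F, hF⟩ := PA.exists_finset_of_isOpen hU hτO
  obtain ⟨p, hp⟩ := exists_state_of_mem_TA H τ.2 F
  obtain ⟨τ', hτ', hp'⟩ := exists_mem_HTA_inter_HFA H hw hsep p
  refine ⟨⟨τ', HTA_subset_TA hτ'.1⟩, hF τ' fun x hx => ?_, hτ'⟩
  have : x = τ'.1.symm (τ.1.1 x) := hp' _ _ (hp x hx)
  rw [this, Equiv.apply_symm_apply, ← this]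

end Genericity

/-! ### Lengths of reduced words in the amalgam. -/

section WordLength

open Monoid (PushoutI CoprodI)

variable {G : Fin 2 → Type*} {S : Type*} [∀ j, Group (G j)] [Group S] {φ : ∀ j, S →* G j}

/-- A product of `n` elements of the factors has a reduced form of length at most `n`. -/
theorem exists_reduced_form (φ : ∀ j, S →* G j) (L : List (Σ j, G j)) :
    ∃ (s : S) (w : CoprodI.Word G), PushoutI.Reduced φ w ∧
    (L.map fun g => PushoutI.of (φ := φ) g.1 g.2).prod =
      PushoutI.base φ s * PushoutI.ofCoprodI w.prod ∧ w.toList.length ≤ L.length := by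
  induction L with
  | nil => exact ⟨1, .empty, by simp [PushoutI.Reduced, CoprodI.Word.empty], by simp, le_rfl⟩
  | cons g L ih =>
    obtain ⟨i, g⟩ := g
    obtain ⟨s, w, hw, e, hl⟩ := ih
    have e' : PushoutI.of i g * (PushoutI.base φ s * PushoutI.ofCoprodI w.prod) =
        PushoutI.of i (g * φ i s) * PushoutI.ofCoprodI w.prod := by
      rw [map_mul, PushoutI.of_apply_eq_base, mul_assoc]
    have hone : ∀ {x : G i}, x ∉ (φ i).range → x ≠ 1 := fun hx h => hx (h ▸ one_mem _)
    rw [List.map_cons, List.prod_cons, e, e', List.length_cons]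
    have hnew : ∀ (v : CoprodI.Word G), PushoutI.Reduced φ v → v.fstIdx ≠ some i → ∀ x : G i,
        ∃ (s : S) (w : CoprodI.Word G), PushoutI.Reduced φ w ∧
          PushoutI.of i x * PushoutI.ofCoprodI v.prod =
            PushoutI.base φ s * PushoutI.ofCoprodI w.prod ∧
          w.toList.length ≤ v.toList.length + 1 := by
      intro v hv hvi x
      by_cases hx : x ∈ (φ i).range
      · obtain ⟨t, rfl⟩ := hx
        exact ⟨t, v, hv, by rw [PushoutI.of_apply_eq_base], Nat.le_succ _⟩
      · refine ⟨1, .cons x v hvi (hone hx), ?_, by simp, by simp [CoprodI.Word.cons]⟩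
        intro y hy
        rcases List.mem_cons.1 hy with rfl | hy
        exacts [hx, hv y hy]
    by_cases hi : w.fstIdx = some i
    · induction w using CoprodI.Word.consRecOn with
      | empty => simp [CoprodI.Word.fstIdx, CoprodI.Word.empty] at hi
      | cons j x v hvj hx1 _ =>
        obtain rfl : j = i := by simpa using hi
        obtain ⟨t, u, hu, eu, hul⟩ := hnew v
          (fun y hy => hw y (List.mem_cons_of_mem _ hy)) hvj (g * φ j s * x)
        refine ⟨t, u, hu, ?_, hul.trans ?_⟩
        · rw [← eu, CoprodI.Word.prod_cons, map_mul PushoutI.ofCoprodI, PushoutI.ofCoprodI_of,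
            ← mul_assoc, ← map_mul]
        · simp only [CoprodI.Word.cons, List.length_cons] at hl
          omega
    · obtain ⟨t, u, hu, eu, hul⟩ := hnew w hw hi (g * φ i s)
      exact ⟨t, u, hu, eu, hul.trans (by omega)⟩

/-- A reduced word and its normal form have the same length, and multiplication by Σ on the left
changes only the head of a normal word; normal forms are unique. -/
theorem reduced_length_unique (hφ : ∀ j, Function.Injective (φ j)) {s t : S}
    {w v : CoprodI.Word G} (hw : PushoutI.Reduced φ w) (hv : PushoutI.Reduced φ v)
    (e : PushoutI.base φ s * PushoutI.ofCoprodI w.prod =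
      PushoutI.base φ t * PushoutI.ofCoprodI v.prod) : w.toList.length = v.toList.length := by
  obtain ⟨d⟩ := PushoutI.NormalWord.transversal_nonempty φ hφ
  obtain ⟨w', hw', hwl⟩ := hw.exists_normalWord_prod_eq d
  obtain ⟨v', hv', hvl⟩ := hv.exists_normalWord_prod_eq d
  rw [← hw', ← hv', ← PushoutI.NormalWord.prod_base_smul, ← PushoutI.NormalWord.prod_base_smul]
    at e
  have h₀ : s • w' = t • v' := PushoutI.NormalWord.prod_injective e
  have h : (s • w').toList = (t • v').toList := by rw [h₀]
  change w'.toList = v'.toList at h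
  have h1 := congrArg List.length hwl
  have h2 := congrArg List.length hvl
  rw [List.length_map, List.length_map] at h1 h2
  rw [← h1, ← h2, h]

/-- The product of the alternating word of length `n` with letters `c`, that starts in the
factor `k`. -/
def altProd (φ : ∀ j, S →* G j) (c : ∀ j, G j) : Fin 2 → ℕ → Amalgam φ
  | _, 0 => 1
  | k, n + 1 => PushoutI.of k (c k) * altProd φ c k.rev n

theorem exists_reduced_altProd {c : ∀ j, G j} (hc : ∀ j, c j ∉ (φ j).range) (n : ℕ) :
    ∀ k : Fin 2, ∃ w : CoprodI.Word G, PushoutI.Reduced φ w ∧ w.toList.length = n ∧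
      PushoutI.ofCoprodI w.prod = altProd φ c k n ∧ w.fstIdx ≠ some k.rev := by
  induction n with
  | zero => exact fun k => ⟨.empty, by simp [PushoutI.Reduced, CoprodI.Word.empty], rfl,
      by simp [altProd], by simp [CoprodI.Word.fstIdx, CoprodI.Word.empty]⟩
  | succ n ih =>
    intro k
    obtain ⟨w, hw, hl, hp, hk⟩ := ih k.rev
    rw [Fin.rev_rev] at hk
    refine ⟨.cons (c k) w hk fun h => hc k (h ▸ one_mem _), ?_, by simp [CoprodI.Word.cons, hl],
      by simp [altProd, hp], ?_⟩
    · intro y hy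
      rcases List.mem_cons.1 hy with rfl | hy
      exacts [hc k, hw y hy]
    · rw [CoprodI.Word.fstIdx_cons]
      clear * -
      revert k
      decide

theorem le_length_of_altProd_eq (hφ : ∀ j, Function.Injective (φ j)) {c : ∀ j, G j}
    (hc : ∀ j, c j ∉ (φ j).range) {k : Fin 2} {n : ℕ} {L : List (Σ j, G j)}
    (h : altProd φ c k n = (L.map fun g => PushoutI.of (φ := φ) g.1 g.2).prod) :
    n ≤ L.length := by
  obtain ⟨w, hw, rfl, hp, -⟩ := exists_reduced_altProd hc n k
  obtain ⟨s, v, hv, e, hl⟩ := exists_reduced_form φ L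
  rw [← h, ← hp, ← one_mul (PushoutI.ofCoprodI w.prod), ← map_one (PushoutI.base φ)] at e
  exact (reduced_length_unique hφ hw hv e).trans_le hl

end WordLength

/-! ### Geodesic rays and fixed half-trees in the Bass–Serre tree. -/

section Tree

open Monoid (PushoutI)

variable {G : Fin 2 → Type*} {S : Type*} [∀ j, Group (G j)] [Group S] {φ : ∀ j, S →* G j}

theorem src_mk (j : Fin 2) (γ : Amalgam φ) : (bassSerreTree φ).src ⟨j, (γ : Amalgam φ ⧸ _)⟩ =
    ⟨j, (γ : Amalgam φ ⧸ factor φ j)⟩ := rfl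

theorem bar_mk (j : Fin 2) (q : Amalgam φ ⧸ edgeGroup φ) :
    (bassSerreTree φ).bar ⟨j, q⟩ = ⟨j.rev, q⟩ := rfl

theorem rng_mk (j : Fin 2) (γ : Amalgam φ) : (bassSerreTree φ).rng ⟨j, (γ : Amalgam φ ⧸ _)⟩ =
    ⟨j.rev, (γ : Amalgam φ ⧸ factor φ j.rev)⟩ := rfl

theorem vertex_eq_iff {j : Fin 2} {γ δ : Amalgam φ} :
    (⟨j, (γ : Amalgam φ ⧸ factor φ j)⟩ : BSVertex φ) = ⟨j, (δ : Amalgam φ ⧸ factor φ j)⟩ ↔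
      ∃ g : G j, δ = γ * PushoutI.of j g := by
  rw [Sigma.mk.injEq]
  simp only [heq_eq_eq, true_and]
  rw [QuotientGroup.eq]
  constructor
  · rintro ⟨g, hg⟩
    exact ⟨g, by rw [hg, mul_inv_cancel_left]⟩
  · rintro ⟨g, rfl⟩
    exact ⟨g, by rw [inv_mul_cancel_left]⟩

/-- Each vertex of the path, both ends included, contributes the letter that changes its coset
representative; hence one letter more than there are edges. -/
theorem IsPath.exists_letters {l : List (BSEdge φ)} : ∀ {j k : Fin 2} {γ δ : Amalgam φ},
    (bassSerreTree φ).IsPath ⟨j, (γ : Amalgam φ ⧸ factor φ j)⟩ l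
      ⟨k, (δ : Amalgam φ ⧸ factor φ k)⟩ →
    ∃ L : List (Σ j, G j), L.length = l.length + 1 ∧
      δ = γ * (L.map fun g => PushoutI.of (φ := φ) g.1 g.2).prod := by
  induction l with
  | nil =>
    intro j k γ δ h
    obtain rfl : j = k := congrArg Sigma.fst h
    obtain ⟨g, hg⟩ := vertex_eq_iff.1 h
    exact ⟨[⟨j, g⟩], rfl, by simpa using hg⟩
  | cons e l ih =>
    rintro j k γ δ ⟨h, hp⟩
    obtain ⟨m, q⟩ := e
    induction q using QuotientGroup.induction_on with
    | H γ' =>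
      rw [src_mk] at h
      obtain rfl : m = j := congrArg Sigma.fst h
      obtain ⟨g, rfl⟩ := vertex_eq_iff.1 h.symm
      rw [rng_mk] at hp
      obtain ⟨L, hL, rfl⟩ := ih hp
      exact ⟨⟨m, g⟩ :: L, by simp [hL], by simp [mul_assoc]⟩

/-- The alternating sequence of indices. -/
def altIdx (k : Fin 2) (n : ℕ) : Fin 2 := Fin.rev^[n] k

theorem altIdx_succ (k : Fin 2) (n : ℕ) : altIdx k (n + 1) = (altIdx k n).rev :=
  Function.iterate_succ_apply' _ _ _

/-- The partial products of an alternating word. -/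
def altSeq (φ : ∀ j, S →* G j) (c : ∀ j, G j) (k : Fin 2) : ℕ → Amalgam φ
  -- With this initial value the next term is 1, so the ray below starts with an edge of the trivial
  -- coset.
  | 0 => (PushoutI.of k (c k))⁻¹
  | n + 1 => altSeq φ c k n * PushoutI.of (altIdx k n) (c (altIdx k n))

theorem altSeq_add (c : ∀ j, G j) (k : Fin 2) (n : ℕ) : ∀ a : ℕ,
    altSeq φ c k (a + n) = altSeq φ c k a * altProd φ c (altIdx k a) n := by
  induction n with
  | zero => exact fun a => (mul_one _).symm
  | succ n ih =>
    intro a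
    rw [show a + (n + 1) = a + 1 + n by omega, ih (a + 1), altProd, altIdx_succ, altSeq,
      mul_assoc]

/-- A geodesic ray in the Bass-Serre tree. -/
def altRay (hφ : ∀ j, Function.Injective (φ j)) {c : ∀ j, G j} (hc : ∀ j, c j ∉ (φ j).range)
    (k : Fin 2) : (bassSerreTree φ).Ray where
  edge n := ⟨altIdx k n, (altSeq φ c k (n + 1) : Amalgam φ ⧸ edgeGroup φ)⟩
  rng_edge n := by
    rw [rng_mk, src_mk, altIdx_succ, vertex_eq_iff]
    exact ⟨c (altIdx k n).rev, by rw [altSeq, altIdx_succ]⟩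
  geodesic a b hab l hl := by
    have hsrc : ∀ a, (bassSerreTree φ).src
        ⟨altIdx k a, (altSeq φ c k (a + 1) : Amalgam φ ⧸ edgeGroup φ)⟩ =
        ⟨altIdx k a, (altSeq φ c k a : Amalgam φ ⧸ factor φ (altIdx k a))⟩ := fun a => by
      rw [src_mk, eq_comm, vertex_eq_iff]
      exact ⟨c (altIdx k a), rfl⟩
    -- The start is represented by the term of index `a` and the end by that of index `b + 1`. The
    -- product between them has `b + 1 - a` letters, which matches the extra letter of a path.
    rw [hsrc, src_mk] at hl
    obtain ⟨L, hL, e⟩ := IsPath.exists_letters hl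
    obtain ⟨n, rfl⟩ := Nat.exists_eq_add_of_le hab
    rw [Nat.add_assoc, altSeq_add, mul_right_inj] at e
    have := le_length_of_altProd_eq hφ hc e
    omega

theorem of_mem_edgeGroup (hφ : ∀ j, Function.Injective (φ j)) {j : Fin 2} {g : G j}
    (h : PushoutI.of j g ∈ edgeGroup φ) : g ∈ (φ j).range := by
  obtain ⟨s, hs⟩ := h
  exact ⟨s, PushoutI.of_injective hφ j (by rw [PushoutI.of_apply_eq_base, hs])⟩

theorem altRay_edge_mem_halfGraph (hφ : ∀ j, Function.Injective (φ j)) {c : ∀ j, G j}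
    (hc : ∀ j, c j ∉ (φ j).range) (k : Fin 2) (n : ℕ) :
    (altRay hφ hc k).edge n ∈ (bassSerreTree φ).halfGraph ((altRay hφ hc k).edge 0) := by
  set ω := altRay hφ hc k with hω
  have hne : ∀ n, ω.edge (n + 1) ≠ (bassSerreTree φ).bar (ω.edge n) := by
    intro n h
    have h' : (altSeq φ c k (n + 1 + 1) : Amalgam φ ⧸ edgeGroup φ) = altSeq φ c k (n + 1) :=
      eq_of_heq (Sigma.mk.inj h).2
    rw [eq_comm, QuotientGroup.eq, show altSeq φ c k (n + 1 + 1) = altSeq φ c k (n + 1) * _ from rfl,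
      inv_mul_cancel_left] at h'
    exact hc _ (of_mem_edgeGroup hφ h')
  have hl : ω.edge 0 :: (List.range n).map (fun m => ω.edge (m + 1)) =
      (List.range (n + 1)).map ω.edge := by
    rw [List.range_succ_eq_map, List.map_cons, List.map_map]
    rfl
  refine ⟨(List.range n).map (fun m => ω.edge (m + 1)), ?_, ?_, Or.inl ?_⟩
  · rw [SerreGraph.IsReducedPath, hl, List.isChain_map, List.isChain_range_succ]
    exact fun m _ => ⟨ω.rng_edge m, hne m⟩
  · rw [hl]
    intro h
    obtain ⟨m, -, hm⟩ := List.mem_map.1 h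
    rcases m with _ | m
    · exact (bassSerreTree φ).bar_ne _ hm.symm
    -- If the ray used the antipode of its first edge, it would return to its vertex of index 1;
    -- being geodesic it could do so only at once, by backtracking.
    · have h1 : (bassSerreTree φ).src (ω.edge 1) = (bassSerreTree φ).src (ω.edge (m + 1)) := by
        rw [hm, ← ω.rng_edge 0]
        rfl
      have h2 := ω.geodesic 1 (m + 1) (by omega) [] h1
      obtain rfl : m = 0 := by simpa using h2
      exact hne 0 hm
  · simp only [hl]
    simp [List.getLast_map]

theorem base_smul_edge {γ : Amalgam φ} {s t : S} (j : Fin 2)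
    (h : PushoutI.base φ s * γ = γ * PushoutI.base φ t) :
    PushoutI.base φ s • (⟨j, (γ : Amalgam φ ⧸ edgeGroup φ)⟩ : BSEdge φ) =
      ⟨j, (γ : Amalgam φ ⧸ edgeGroup φ)⟩ := by
  change (⟨j, ((PushoutI.base φ s * γ : Amalgam φ) : Amalgam φ ⧸ edgeGroup φ)⟩ : BSEdge φ) = _
  rw [h]
  congr 1
  rw [eq_comm, QuotientGroup.eq, inv_mul_cancel_left]
  exact ⟨t, rfl⟩

/-- An element that cannot be conjugated out of the common subgroup along a path fixes all the
edges of this path. -/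
theorem base_smul_getLast {s : S} (l : List (BSEdge φ)) : ∀ {j : Fin 2} {γ : Amalgam φ} {t : S},
    PushoutI.base φ s * γ = γ * PushoutI.base φ t → ¬ Sep φ j.rev t →
    (bassSerreTree φ).IsReducedPath (⟨j, (γ : Amalgam φ ⧸ edgeGroup φ)⟩ :: l) →
    ∀ h : (⟨j, (γ : Amalgam φ ⧸ edgeGroup φ)⟩ :: l : List (BSEdge φ)) ≠ [],
    PushoutI.base φ s • (List.getLast _ h) = List.getLast _ h := by
  induction l with
  | nil => exact fun h _ _ _ => base_smul_edge _ h
  | cons f l ih =>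
    intro j γ t h ht hp hne
    rw [List.getLast_cons (List.cons_ne_nil f l)]
    rw [SerreGraph.IsReducedPath, List.isChain_cons_cons] at hp
    obtain ⟨⟨hf, hfb⟩, hp⟩ := hp
    obtain ⟨m, q⟩ := f
    induction q using QuotientGroup.induction_on with
    | H δ =>
      rw [rng_mk, src_mk] at hf
      obtain rfl : j.rev = m := congrArg Sigma.fst hf
      obtain ⟨g, rfl⟩ := vertex_eq_iff.1 hf
      have hg : g ∉ (φ j.rev).range := by
        rintro ⟨u, rfl⟩
        refine hfb ?_
        rw [bar_mk]
        congr 1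
        rw [eq_comm, QuotientGroup.eq, inv_mul_cancel_left, PushoutI.of_apply_eq_base]
        exact ⟨u, rfl⟩
      have hg' : g⁻¹ ∉ (φ j.rev).range := fun h' => hg (inv_mem_iff.1 h')
      -- Passing to the representative multiplied by `g` conjugates `t` by `g⁻¹`. Either the result
      -- is still in Σ and the induction goes on, or this letter witnesses `Sep`.
      by_cases hs : g⁻¹ * φ j.rev t * g⁻¹⁻¹ ∈ (φ j.rev).range
      · obtain ⟨u, hu⟩ := hs
        refine ih (t := u) ?_ (fun hu' => ht ?_) hp _
        · rw [← PushoutI.of_apply_eq_base φ j.rev u, hu, map_mul, map_mul, inv_inv, map_inv,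
            PushoutI.of_apply_eq_base, ← mul_assoc, h]
          group
        · refine Sep.there _ _ ?_ _ _ _ hg' hu.symm hu'
          clear * -
          revert j
          decide
      · exact absurd (Sep.here _ _ _ hg' hs) ht

/-- In a topologically free action on the boundary, no non-trivial element of the common subgroup
stays in it along all the paths of a half-tree. -/
theorem TopologicallyFree.sep (hφ : ∀ j, Function.Injective (φ j))
    (hp : ∀ j, ∃ g : G j, g ∉ (φ j).range)
    (hfree : TopologicallyFree (Amalgam φ) (bassSerreTree φ).Boundary) (s : S) (hs : s ≠ 1)
    (i : Fin 2) : Sep φ i s := by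
  by_contra hsep
  choose c hc using hp
  -- The first edge of this ray points to the vertex of the factor `i`, where the walks in `Sep φ i
  -- s` begin; the ray itself shows that the half-tree has an end.
  set ω := altRay hφ hc i.rev with hω
  have he : ω.edge 0 = ⟨i.rev, ((1 : Amalgam φ) : Amalgam φ ⧸ edgeGroup φ)⟩ := by
    have h1 : altSeq φ c i.rev 1 = 1 := inv_mul_cancel _
    change (⟨altIdx i.rev 0, (altSeq φ c i.rev 1 : Amalgam φ ⧸ edgeGroup φ)⟩ : BSEdge φ) = _
    rw [h1]
    rfl
  have hfix : ∀ f ∈ (bassSerreTree φ).halfGraph (ω.edge 0), PushoutI.base φ s • f = f := by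
    rintro f ⟨l, hl, -, h⟩
    have key : PushoutI.base φ s • List.getLast (ω.edge 0 :: l) (List.cons_ne_nil _ _) =
        List.getLast (ω.edge 0 :: l) (List.cons_ne_nil _ _) := by
      simp only [he] at hl ⊢
      exact base_smul_getLast l (t := s) (by rw [one_mul, mul_one])
        (by rwa [Fin.rev_rev]) hl _
    rcases h with h | h
    · rwa [h] at key
    · rw [h, ← SerreGraph.IsGraphAction.bar_smul] at key
      have key' := congrArg (bassSerreTree φ).bar key
      rwa [SerreGraph.bar_bar, SerreGraph.bar_bar] at key'
  have h1 : PushoutI.base φ s = 1 := by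
    refine hfree _ ⟨(bassSerreTree φ).boundaryOf (ω.edge 0),
      TopologicalSpace.isOpen_generateFrom_of_mem ⟨_, rfl⟩,
      ⟨ω.toBoundary, ω, altRay_edge_mem_halfGraph hφ hc i.rev, rfl⟩, ?_⟩
    rintro _ ⟨ω', hω', rfl⟩
    rw [SerreGraph.smul_toBoundary]
    congr 1
    exact SerreGraph.Ray.ext fun n => hfix _ (hω' n)
  exact hs (PushoutI.base_injective hφ (h1.trans (map_one _).symm))

end Tree

/-- If the required element did not exist for `g`, the cosets of 1 and `g⁻¹` would be the only ones.
Inversion turns the right cosets in `Wide` into left cosets. -/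
theorem wide_of_three_le {G : Fin 2 → Type*} {S : Type*} [∀ j, Group (G j)] [Group S]
    {φ : ∀ j, S →* G j} {j : Fin 2} (h : (3 : ℕ∞) ≤ ENat.card (G j ⧸ (φ j).range)) :
    Wide φ j := by
  intro g
  by_contra! hg
  have huniv : (Set.univ : Set (G j ⧸ (φ j).range)) ⊆
      {((1 : G j) : G j ⧸ (φ j).range), ((g⁻¹ : G j) : G j ⧸ (φ j).range)} := by
    intro q _
    induction q using QuotientGroup.induction_on with
    | H x =>
      by_cases hx : x⁻¹ ∈ (φ j).range
      · left
        rw [QuotientGroup.eq]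
        simpa using hx
      · right
        rw [Set.mem_singleton_iff, QuotientGroup.eq]
        exact hg _ hx
  have h2 := (Set.encard_le_encard huniv).trans (Set.encard_insert_le _ _)
  rw [Set.encard_univ, Set.encard_singleton] at h2
  exact absurd (h.trans h2) (by decide)

/-! ### The main results. -/

section Main

variable {G : Fin 2 → Type*} {S : Type*} [∀ j, Group (G j)] [Group S] {φ : ∀ j, S →* G j}

theorem generic_actions [∀ j, Countable (G j)] (hφ : ∀ j, Function.Injective (φ j))
    (hnd : NonDegenerate φ)
    (hfree : TopologicallyFree (Amalgam φ) (bassSerreTree φ).Boundary)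
    (X : Fin 2 → Type*) [∀ j, Countable (X j)] [∀ j, MulAction (G j) (X j)]
    (hX : ∀ (j : Fin 2) (g : G j) (x : X j), g • x = x → g = 1)
    (hX' : ∀ j, Infinite (MulAction.orbitRel.Quotient (G j) (X j))) :
    (HTA φ X ∩ HFA φ X).Nonempty ∧ HTA φ X ∩ HFA φ X ⊆ TA φ X ∧
      IsGδ {τ : TA φ X | (τ : PA φ X) ∈ HTA φ X ∩ HFA φ X} ∧
      Dense {τ : TA φ X | (τ : PA φ X) ∈ HTA φ X ∩ HFA φ X} := by
  have hp : ∀ j, ∃ g : G j, g ∉ (φ j).range := fun j => by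
    by_contra! h
    exact hnd.1 j (Subgroup.eq_top_iff' _ |>.2 h)
  have H : FreePair φ X := ⟨hφ, hX, hX', hp⟩
  have hw : ∀ i j : Fin 2, i ≠ j → Wide φ i ∨ Wide φ j := by
    intro i j hij
    obtain ⟨k, hk⟩ := hnd.2
    have hk' := wide_of_three_le hk
    obtain rfl | rfl : k = i ∨ k = j := by omega
    exacts [Or.inl hk', Or.inr hk']
  have hsep := TopologicallyFree.sep hφ hp hfree
  have := countable_amalgam (φ := φ)
  refine ⟨?_, fun τ h => HTA_subset_TA h.1, ?_, dense_HTA_inter_HFA H hw hsep⟩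
  · obtain ⟨τ, hτ, -⟩ := exists_mem_HTA_inter_HFA H hw hsep (State.empty φ X)
    exact ⟨τ, hτ⟩
  · exact isGδ_HTA_inter_HFA.preimage continuous_subtype_val

/-- A highly transitive and highly faithful action on a countable infinite set can be transported
to the natural numbers. -/
theorem exists_action_nat {Γ Y : Type*} [Group Γ] [Countable Y] [Infinite Y]
    {α : Γ →* Equiv.Perm Y} (h : IsHighlyTransitive α) (h' : IsHighlyFaithful α) :
    ∃ β : Γ →* Equiv.Perm ℕ, IsHighlyTransitive β ∧ IsHighlyFaithful β := by
  obtain ⟨e⟩ := nonempty_equiv_of_countable (α := Y) (β := ℕ)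
  have hβ : ∀ γ n, (e.permCongrHom.toMonoidHom.comp α) γ n = e (α γ (e.symm n)) :=
    fun _ _ => rfl
  refine ⟨e.permCongrHom.toMonoidHom.comp α, fun k x y hx hy => ?_, fun F hF => ?_⟩
  · obtain ⟨γ, hγ⟩ := h k (e.symm ∘ x) (e.symm ∘ y) (e.symm.injective.comp hx)
      (e.symm.injective.comp hy)
    refine ⟨γ, fun i => ?_⟩
    have := hγ i
    simp only [Function.comp_apply] at this
    rw [hβ, this, Equiv.apply_symm_apply]
  · refine ((h' F hF).image e.injective.injOn).mono ?_
    rintro _ ⟨y, hy, rfl⟩ γ hγ he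
    rw [hβ, Equiv.symm_apply_apply, EmbeddingLike.apply_eq_iff_eq] at he
    exact hy γ hγ he

theorem IsHighlyFaithful.injective {Γ Y : Type*} [Group Γ] {α : Γ →* Equiv.Perm Y}
    (h : IsHighlyFaithful α) : Function.Injective α := by
  rw [injective_iff_map_eq_one]
  intro γ hγ
  by_contra hne
  obtain ⟨x, hx⟩ := (h {γ} (by simpa [eq_comm] using hne)).nonempty
  exact hx γ (Finset.mem_singleton_self γ) (by rw [hγ]; rfl)

theorem exists_highlyTransitive_highlyFaithful [∀ j, Countable (G j)]
    (hφ : ∀ j, Function.Injective (φ j)) (hnd : NonDegenerate φ)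
    (hfree : TopologicallyFree (Amalgam φ) (bassSerreTree φ).Boundary) :
    ∃ β : Amalgam φ →* Equiv.Perm ℕ, IsHighlyTransitive β ∧ IsHighlyFaithful β := by
  -- Countably many copies of the translation action: a free action with infinitely many orbits, to
  -- which the generic statement applies.
  let act : ∀ j, MulAction (G j) (G j × ℕ) := fun j =>
    { smul := fun g x => (g * x.1, x.2)
      one_smul := fun x => Prod.ext (one_mul x.1) rfl
      mul_smul := fun g h x => Prod.ext (mul_assoc g h x.1) rfl }
  obtain ⟨⟨τ, hτ, hτ'⟩, -⟩ := generic_actions hφ hnd hfree (fun j => G j × ℕ)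
    (fun j g x h => mul_eq_right.1 (congrArg Prod.fst h)) (fun j => by
      refine Infinite.of_injective
        (fun n : ℕ => (Quotient.mk _ ((1 : G j), n) : MulAction.orbitRel.Quotient (G j) (G j × ℕ)))
        fun m n h => ?_
      obtain ⟨g, hg⟩ := MulAction.orbitRel_apply.1 (Quotient.exact h)
      exact (congrArg Prod.snd hg).symm)
  exact exists_action_nat hτ hτ'

end Main

end AmalgamHT

theorem theoremE {G : Fin 2 → Type*} {S : Type*} [∀ j, Group (G j)] [Group S]
    [∀ j, Countable (G j)] (φ : ∀ j, S →* G j) (hφ : ∀ j, Function.Injective (φ j))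
    (hnd : AmalgamHT.NonDegenerate φ)
    (hfree : AmalgamHT.TopologicallyFree (AmalgamHT.Amalgam φ)
      (AmalgamHT.bassSerreTree φ).Boundary) :
    -- the amalgam has a highly transitive and highly faithful action
    (∃ (X : Type) (α : AmalgamHT.Amalgam φ →* Equiv.Perm X), Countable X ∧ Infinite X ∧
      AmalgamHT.IsHighlyTransitive α ∧ AmalgamHT.IsHighlyFaithful α) ∧
    -- in particular it is a highly transitive group
    AmalgamHT.IsHighlyTransitiveGroup (AmalgamHT.Amalgam φ) ∧
    -- such actions are generic among the transitive ones built from fixed free actions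
    (∀ (X : Fin 2 → Type*) [∀ j, Countable (X j)] [∀ j, MulAction (G j) (X j)],
      (∀ (j : Fin 2) (g : G j) (x : X j), g • x = x → g = 1) →
      (∀ j, Infinite (MulAction.orbitRel.Quotient (G j) (X j))) →
      (AmalgamHT.HTA φ X ∩ AmalgamHT.HFA φ X).Nonempty ∧
      AmalgamHT.HTA φ X ∩ AmalgamHT.HFA φ X ⊆ AmalgamHT.TA φ X ∧
      IsGδ {τ : AmalgamHT.TA φ X | (τ : AmalgamHT.PA φ X) ∈ AmalgamHT.HTA φ X ∩ AmalgamHT.HFA φ X} ∧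
      Dense {τ : AmalgamHT.TA φ X |
        (τ : AmalgamHT.PA φ X) ∈ AmalgamHT.HTA φ X ∩ AmalgamHT.HFA φ X}) := by
  obtain ⟨β, h, h'⟩ := AmalgamHT.exists_highlyTransitive_highlyFaithful hφ hnd hfree
  exact ⟨⟨ℕ, β, inferInstance, inferInstance, h, h'⟩,
    ⟨ℕ, β, inferInstance, inferInstance, h'.injective, h⟩,
    fun X _ _ hX hX' => AmalgamHT.generic_actions hφ hnd hfree X hX hX'⟩
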